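/- **Online Stochastic Matching.** An instance consists of a finite bipartite type graph $G=(I,J,E)$, where $I$ is the set of online vertex types and $J$ the set of offline vertices, and of an arrival rate $\lambda_i>0$ for each $i\in I$. Write $J_i$ and $I_j$ for the neighbourhoods of $i\in I$ and $j\in J$. During the time horizon from $0$ to $1$, online vertices of the types $i\in I$ arrive according to independent Poisson processes with rates $\lambda_i$. An arriving vertex of type $i$ can be matched to an unmatched vertex of $J_i$, and this decision is immediate and irrevocable. The aim is to maximize the size of the matching. Let $\mathrm{OPT}$ be the size of a maximum matching of the realized bipartite graph. **Natural LP.** Maximize $\sum_{(i,j)\in E}x_{ij}$ over $(x_{ij})_{(i,j)\in E}$ subject to $$\sum_{j\in J_i}x_{ij}\le\lambda_i\ \ (i\in I),\qquad \sum_{i\in S}x_{ij}\le 1-\exp\Big(-\sum_{i\in S}\lambda_i\Big)\ \ (j\in J,\ S\subseteq I_j),\qquad x_{ij}\ge 0\ \ ((i,j)\in E).$$ **Stochastic SWOR.** Fix an optimal solution $x$ of the Natural LP. When an online vertex of type $i$ arrives, match it, using fresh randomness, to an unmatched neighbour $j\in J_i$ chosen with probability proportional to $x_{ij}$; if every unmatched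 neighbour $j$ of $i$ has $x_{ij}=0$ (or there is no unmatched neighbour), leave it unmatched. Let $\mathrm{ALG}$ be the size of the resulting matching. **Theorem.** Stochastic SWOR is at least $0.707$-competitive for Online Stochastic Matching, also against the Natural LP optimum: for every instance and every optimal solution $x$ of the Natural LP, the expectations of $\mathrm{ALG}$ and $\mathrm{OPT}$ (over the arrivals and the randomness of the algorithm) are finite, and $$\mathbb E[\mathrm{ALG}]\ \ge\ 0.707\sum_{(i,j)\in E}x_{ij}\qquad\text{and}\qquad \mathbb E[\mathrm{ALG}]\ \ge\ 0.707\;\mathbb E[\mathrm{OPT}].$$ -/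

import Mathlib

open MeasureTheory ProbabilityTheory
open scoped NNReal ENNReal

noncomputable section

/-- `N` is a (homogeneous) Poisson process on `[0, ∞)` with rate `r`: a counting process started
at `0`, with almost surely non-decreasing and right-continuous sample paths, with independent
increments, whose increment over `(s, t]` is Poisson distributed with mean `r * (t - s)`.
(Subtraction in `ℕ` is harmless here, since almost every path is non-decreasing.) -/
structure IsPoissonCounting {Ω : Type*} [MeasurableSpace Ω] (N : ℝ≥0 → Ω → ℕ) (r : ℝ≥0)
    (P : Measure Ω) : Prop where
  measurable : ∀ t, Measurable (N t)
  paths : ∀ᵐ ω ∂P, N 0 ω = 0 ∧ Monotone (fun t => N t ω) ∧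
    ∀ t, ContinuousWithinAt (fun s => N s ω) (Set.Ici t) t
  hasIndepIncrements : HasIndepIncrements N P
  increment_law : ∀ s t, s ≤ t →
    HasLaw (fun ω => N t ω - N s ω) (poissonMeasure (r * (t - s))) P

/-- An instance of Online Stochastic Matching: a bipartite type graph between the online vertex
types `I` and the offline vertices `J`, and a positive arrival rate for every online type. -/
structure StochasticMatching (I J : Type*) where
  /-- the edges of the type graph -/
  edges : Finset (I × J)
  /-- the arrival rates of the online types -/
  rate : I → ℝ≥0
  rate_pos : ∀ i, 0 < rate i

namespace StochasticMatching

variable {I J : Type*} [Fintype I] [Fintype J] [DecidableEq I] [DecidableEq J]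

/-- The offline neighbours of the online type `i`. -/
def offlineNbrs (G : StochasticMatching I J) (i : I) : Finset J :=
  Finset.univ.filter fun j => (i, j) ∈ G.edges

/-- The online neighbours (types) of the offline vertex `j`. -/
def onlineNbrs (G : StochasticMatching I J) (j : J) : Finset I :=
  Finset.univ.filter fun i => (i, j) ∈ G.edges

/-! ### The Natural LP

A vector indexed by the edges is represented by a function `x : I → J → ℝ` of which only the
values on edges matter. -/

/-- The objective of the Natural LP. -/
def lpValue (G : StochasticMatching I J) (x : I → J → ℝ) : ℝ :=
  ∑ e ∈ G.edges, x e.1 e.2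

/-- The constraints of the Natural LP. -/
structure LPFeasible (G : StochasticMatching I J) (x : I → J → ℝ) : Prop where
  online : ∀ i, ∑ j ∈ G.offlineNbrs i, x i j ≤ (G.rate i : ℝ)
  offline : ∀ j, ∀ S ⊆ G.onlineNbrs j,
    ∑ i ∈ S, x i j ≤ 1 - Real.exp (-∑ i ∈ S, (G.rate i : ℝ))
  nonneg : ∀ e ∈ G.edges, 0 ≤ x e.1 e.2

/-- `x` is an optimal solution of the Natural LP. -/
def LPOptimal (G : StochasticMatching I J) (x : I → J → ℝ) : Prop :=
  G.LPFeasible x ∧ ∀ y, G.LPFeasible y → G.lpValue y ≤ G.lpValue x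

/-! ### Arrivals -/

/-- The online vertices of the types `i : I` arrive by independent Poisson processes `N i`
with rates `G.rate i`; `N i t` is the number of type-`i` arrivals up to time `t`. -/
structure PoissonArrivals {Ω : Type*} [MeasurableSpace Ω] (G : StochasticMatching I J)
    (N : I → ℝ≥0 → Ω → ℕ) (P : Measure Ω) : Prop where
  isPoissonCounting : ∀ i, IsPoissonCounting (N i) (G.rate i) P
  indep : iIndepFun (fun i ω t => N i t ω) P

/-- The time of arrival number `k` (counting from `0`) of a counting path `c`. -/
def arrivalTime (c : ℝ≥0 → ℕ) (k : ℕ) : ℝ≥0 := sInf {t | k < c t}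

/-- For a family `c` of counting paths, one per type, the sequence of the types of all online
vertices that arrive within the time horizon from `0` to `1`, in the order of arrival.
(Simultaneous arrivals, an event of probability zero, are put in some order.) -/
def arrivalSeq (c : I → ℝ≥0 → ℕ) : List I :=
  (((Finset.univ.sigma fun i => Finset.range (c i 1)).toList : List (Σ _ : I, ℕ)).insertionSort
    fun a b => arrivalTime (c a.1) a.2 ≤ arrivalTime (c b.1) b.2).map Sigma.fst

/-! ### The optimal matching in hindsight -/

/-- `M` is a matching of the realized bipartite graph whose online vertices are the positions `k`
of the list `w` of types, `k` being adjacent to the offline neighbours of its type: a set of edges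
no two of which share an endpoint. -/
structure IsMatching (G : StochasticMatching I J) (w : List I)
    (M : Finset (Fin w.length × J)) : Prop where
  edge : ∀ e ∈ M, (w.get e.1, e.2) ∈ G.edges
  online : ∀ e ∈ M, ∀ e' ∈ M, e.1 = e'.1 → e = e'
  offline : ∀ e ∈ M, ∀ e' ∈ M, e.2 = e'.2 → e = e'

open Classical in
/-- The size of a maximum matching of the realized bipartite graph. -/
def hindsightOpt (G : StochasticMatching I J) (w : List I) : ℕ :=
  (Finset.univ.filter (G.IsMatching w)).sup Finset.card

/-! ### Stochastic SWOR -/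

/-- The sampling masses used for an arrival of type `i` when the offline vertices in `M` are
already matched: `x i j` for an unmatched neighbour `j` of `i`, and `0` for any other `j`. -/
def sworMass (G : StochasticMatching I J) (x : I → J → ℝ) (M : Finset J) (i : I) (j : J) :
    ℝ≥0∞ :=
  if j ∈ G.offlineNbrs i \ M then ENNReal.ofReal (x i j) else 0

open Classical in
/-- The random decision of Stochastic SWOR for an arrival of type `i` when the offline vertices in
`M` are already matched: match to an unmatched neighbour `j` with probability proportional to
`x i j`; if all these masses are zero, leave the arrival unmatched (`none`). -/
def sworDecision (G : StochasticMatching I J) (x : I → J → ℝ) (M : Finset J) (i : I) :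
    PMF (Option J) :=
  if h : ∑' j, G.sworMass x M i j ≠ 0 then
    (PMF.normalize (G.sworMass x M i) h (by
      rw [tsum_fintype]
      refine ENNReal.sum_ne_top.2 fun j _ => ?_
      unfold sworMass
      split_ifs <;> simp)).map some
  else PMF.pure none

/-- The random set of matched offline vertices after Stochastic SWOR, started with matched set `M`,
has processed a sequence of arrivals with the given types, with fresh randomness for each one. -/
def sworRun (G : StochasticMatching I J) (x : I → J → ℝ) : Finset J → List I → PMF (Finset J)
  | M, [] => PMF.pure M
  | M, i :: w => (G.sworDecision x M i).bind fun d => sworRun G x (M ∪ d.toFinset) w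

/-- The expected size of the matching of Stochastic SWOR on the sequence `w` of arrivals, over the
randomness of the algorithm. Every matched online vertex matches one new offline vertex, so the
size of the matching is the number of matched offline vertices. -/
def sworSize (G : StochasticMatching I J) (x : I → J → ℝ) (w : List I) : ℝ :=
  ∑ M : Finset J, (G.sworRun x ∅ w M).toReal * (M.card : ℝ)

end StochasticMatching

end

/-!
The proof is a potential function argument for the Markov process of the set `M` of matched offline
vertices. Let `x` be a feasible solution of the Natural LP. For an online type `i` let `y i` be the
mass `∑ x i j` over its unmatched neighbours `j`; for an offline vertex `j` let `x j = ∑ x i j` be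
its load. An unmatched vertex `j` gets matched at rate `r j = ∑ rate i * x i j / y i`. Let
`L = ∑ x j` over the unmatched vertices `j` (`massLeft`), and `Q = ∑ y i ^ 2 / rate i` (`energy`),
which is the sum over the unmatched `j` of the shares `s j = ∑ x i j * y i / rate i`. Matching `j`
decreases `L` by `x j` and `Q` by `2 * s j - q j`, where `q j = ∑ x i j ^ 2 / rate i`.

Three facts tie these numbers together: `r j ≥ x j`, since `y i ≤ rate i`; `r j * s j ≥ x j ^ 2`, by
the Cauchy–Schwarz inequality (`load_sq_le`); and `q j ≤ x j - x j ^ 2 / 2`, which is a converse of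
Jensen's inequality for the constraints of the LP at `j` (`sum_sq_div_le`). They show that for
suitable functions `η` and `c` of time the expected growth of the matching makes up for the loss of
the potential `η t * L - c t * Q`, separately for every unmatched vertex (`IsPotential`). In an
early phase, `c` grows exponentially at rate `4 / 3` and `η = 1 - c / 2` (`isPotential_early`); in
the late phase both are rational functions of an auxiliary variable (`isPotential_late`), and the
inequality comes down to `drift_poly_nonneg`. The potential vanishes at time `1`, and at time `0` it
is at least `(η 0 - c 0) * L`, where `η 0 - c 0 ≥ 0.707` and `L` is the value of `x`.

To pass from Poisson processes to this Markov process, the time horizon is cut into short slots,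
each of which contributes a letter: the type of the vertex arriving in it, if there is exactly one.
The letters are independent and identically distributed (`integral_slotList`), so that the potential
argument becomes a backward induction over the slots (`slotOp_iterate_card_ge`). Almost surely, no
slot holds two arrivals once the slots are short enough, and then the letters spell the sequence of
arrivals (`arrivalSeq_eq`); dominated convergence (`integrable_and_tendsto`) finishes the proof.

The comparison with the hindsight optimum holds because the expected numbers of times that a maximum
matching uses the edges form a feasible solution of the Natural LP (`lpFeasible_optCount`).
-/

noncomputable section

/-! ### The drift inequality -/

/-- The polynomial form of the drift inequality of the late phase. As a quadratic in `y` it is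
nonnegative because either its linear coefficient is nonnegative or its discriminant is
nonpositive; the latter comes down to `(4u - 3) u (7 - 8u)² ≤ 32 (1 - u)³`. -/
lemma drift_poly_nonneg {u σ y : ℝ} (hu : 3 / 4 ≤ u) (hu1 : u ≤ 1) (hσ : u ≤ σ) (hy : 0 ≤ y) :
    0 ≤ 8 * u * (1 - u) * (σ - 1) ^ 2
      + σ * y * (4 * u * (4 * u - 3) * (σ - 1) + σ * (4 * u - 3) ^ 2)
      + σ ^ 2 * (4 * u - 3) * y ^ 2 := by
  have hσ0 : 0 < σ := by linarith
  have he : 0 ≤ 4 * u - 3 := by linarith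
  have h1 : 0 ≤ 8 * u * (1 - u) * (σ - 1) ^ 2 := by
    have : 0 ≤ 1 - u := by linarith
    positivity
  by_cases hb : 0 ≤ 4 * u * (σ - 1) + σ * (4 * u - 3)
  · have : 0 ≤ σ * y * ((4 * u - 3) * (4 * u * (σ - 1) + σ * (4 * u - 3))) := by positivity
    have : 0 ≤ σ ^ 2 * (4 * u - 3) * y ^ 2 := by positivity
    nlinarith
  · push Not at hb
    have hz : 0 < 1 - σ := by nlinarith
    have hu2 : 0 < 1 - u := by linarith
    -- the linear coefficient in `y` is `-σ (4u - 3) k`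
    obtain ⟨k, hk⟩ : ∃ k, k = 4 * u * (1 - σ) - σ * (4 * u - 3) := ⟨_, rfl⟩
    have hk0 : 0 < k := by rw [hk]; linarith
    have hk1 : k * (1 - u) ≤ u * (1 - σ) * (7 - 8 * u) := by
      rw [hk]; nlinarith [mul_nonneg he (sub_nonneg.2 hσ)]
    have h78 : 0 < 7 - 8 * u := by
      by_contra h
      push Not at h
      have : u * (1 - σ) * (7 - 8 * u) ≤ 0 := by
        apply mul_nonpos_of_nonneg_of_nonpos _ h
        have : 0 ≤ u := by linarith
        positivity
      nlinarith [mul_pos hk0 hu2]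
    have hpoly : (4 * u - 3) * u * (7 - 8 * u) ^ 2 ≤ 32 * (1 - u) ^ 3 := by
      have h4 : 7 - 8 * u ≤ 4 * (1 - u) := by linarith
      have h5 : (7 - 8 * u) ^ 2 ≤ (4 * (1 - u)) ^ 2 := by gcongr
      have h6 : (4 * u - 3) * u * (7 - 8 * u) ^ 2 ≤ (4 * u - 3) * u * (4 * (1 - u)) ^ 2 := by
        have : 0 ≤ (4 * u - 3) * u := by nlinarith
        gcongr
      by_cases h8 : u ≤ 84 / 100
      · have h7 : (4 * u - 3) * u ≤ 2 * (1 - u) := by nlinarith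
        nlinarith [sq_nonneg (1 - u)]
      · push Not at h8
        have h10 : 125 / 1000 ≤ 1 - u := by linarith
        have h11 : 7 - 8 * u ≤ 2 * (1 - u) := by linarith
        have h12 : (7 - 8 * u) ^ 2 ≤ 4 * (1 - u) ^ 2 := by nlinarith
        have h13 : (4 * u - 3) * u * (7 - 8 * u) ^ 2 ≤ 1 / 2 * (7 / 8) * (4 * (1 - u) ^ 2) := by
          have : (4 * u - 3) * u ≤ 1 / 2 * (7 / 8) := by nlinarith
          gcongr
        nlinarith [sq_nonneg (1 - u)]
    have hdisc : (4 * u - 3) * k ^ 2 ≤ 32 * u * (1 - u) * (1 - σ) ^ 2 := by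
      have hsq : (k * (1 - u)) ^ 2 ≤ (u * (1 - σ) * (7 - 8 * u)) ^ 2 := by gcongr
      have h6 : (4 * u - 3) * (k * (1 - u)) ^ 2
          ≤ (32 * u * (1 - u) * (1 - σ) ^ 2) * (1 - u) ^ 2 := by
        calc _ ≤ (4 * u - 3) * (u * (1 - σ) * (7 - 8 * u)) ^ 2 := by gcongr
          _ = ((4 * u - 3) * u * (7 - 8 * u) ^ 2) * (u * (1 - σ) ^ 2) := by ring
          _ ≤ (32 * (1 - u) ^ 3) * (u * (1 - σ) ^ 2) := by
            have : 0 ≤ u := by linarith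
            gcongr
          _ = _ := by ring
      have : (4 * u - 3) * k ^ 2 * (1 - u) ^ 2
          ≤ (32 * u * (1 - u) * (1 - σ) ^ 2) * (1 - u) ^ 2 := by
        rwa [mul_pow, ← mul_assoc] at h6
      exact le_of_mul_le_mul_right this (by positivity)
    -- complete the square in `y`
    have hsq : 0 ≤ (4 * u - 3) * (2 * σ * y - k) ^ 2 := by positivity
    have : σ * y * (4 * u * (4 * u - 3) * (σ - 1) + σ * (4 * u - 3) ^ 2)
        = - (σ * y * (4 * u - 3) * k) := by rw [hk]; ring
    rw [this]
    nlinarith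

/-- The coefficient of the energy in the potential of the late phase, as a function of a variable
`u` that decreases from `1` to `3/4`. Together with `lateEta` it solves the linear differential
equations that express equality in the drift inequality for vertices of load `1`, when `u` runs
along `u' = -(2u - 1) / (2u)`. -/
def lateC (u : ℝ) : ℝ := (4 * u - 3) / (3 * (2 * u - 1) ^ 2)

/-- The coefficient of the unmatched mass in the potential of the late phase, as a function of the
same variable `u` as in `lateC`. -/
def lateEta (u : ℝ) : ℝ := (4 * u - 3) * (8 * u - 3) / (6 * (2 * u - 1) ^ 2)

/-- The derivative of `lateC`. -/
def lateC' (u : ℝ) : ℝ := 8 * (1 - u) / (3 * (2 * u - 1) ^ 3)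

/-- The derivative of `lateEta`. -/
def lateEta' (u : ℝ) : ℝ := 4 * u / (3 * (2 * u - 1) ^ 3)

lemma hasDerivAt_lateC {u : ℝ} (hu : 3 / 4 ≤ u) : HasDerivAt lateC (lateC' u) u := by
  have hv : 2 * u - 1 ≠ 0 := by linarith
  have h1 : HasDerivAt (fun u : ℝ => 4 * u - 3) 4 u := by
    simpa using ((hasDerivAt_id u).const_mul 4).sub_const 3
  have h2 : HasDerivAt (fun u : ℝ => 2 * u - 1) 2 u := by
    simpa using ((hasDerivAt_id u).const_mul 2).sub_const 1
  have h3 := h1.fun_div ((h2.fun_pow 2).const_mul 3) (by positivity)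
  unfold lateC lateC'
  refine h3.congr_deriv ?_
  field_simp
  ring

lemma hasDerivAt_lateEta {u : ℝ} (hu : 3 / 4 ≤ u) : HasDerivAt lateEta (lateEta' u) u := by
  have hv : 2 * u - 1 ≠ 0 := by linarith
  have h1 : HasDerivAt (fun u : ℝ => 4 * u - 3) 4 u := by
    simpa using ((hasDerivAt_id u).const_mul 4).sub_const 3
  have h4 : HasDerivAt (fun u : ℝ => 8 * u - 3) 8 u := by
    simpa using ((hasDerivAt_id u).const_mul 8).sub_const 3
  have h2 : HasDerivAt (fun u : ℝ => 2 * u - 1) 2 u := by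
    simpa using ((hasDerivAt_id u).const_mul 2).sub_const 1
  have h3 := (h1.fun_mul h4).fun_div ((h2.fun_pow 2).const_mul 6) (by positivity)
  unfold lateEta lateEta'
  refine h3.congr_deriv ?_
  rw [div_eq_div_iff (by positivity) (by positivity)]
  push_cast
  ring

/-- The drift inequality of the early phase, in which `c' = 4c / 3` and `η = 1 - c / 2`. -/
lemma early_drift {c x r s q : ℝ} (hc : 0 ≤ c) (hc3 : c ≤ 1 / 3) (hx0 : 0 ≤ x) (hx1 : x ≤ 1)
    (hr : x ≤ r) (hrs : x ^ 2 ≤ r * s) (hsx : s ≤ x) (hq : q ≤ x - x ^ 2 / 2) :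
    0 ≤ r * (1 - (1 - c / 2) * x + c * (2 * s - q)) + (-(2 * c / 3)) * x - (4 * c / 3) * s := by
  have hr0 : 0 ≤ r := hx0.trans hr
  have h1 : r * c * q ≤ r * c * (x - x ^ 2 / 2) := by gcongr
  have h2 : c * x ^ 2 ≤ c * (r * s) := by gcongr
  have h3 : c * s ≤ c * x := by gcongr
  have h4 : x * ((1 - x) * (1 - c * x / 2)) ≤ r * ((1 - x) * (1 - c * x / 2)) := by
    have : 0 ≤ 1 - c * x / 2 := by nlinarith
    have : 0 ≤ 1 - x := by linarith
    gcongr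
  have h5 : 0 ≤ x * ((1 - x) * (1 - c * x / 2 - 2 * c)) := by
    have : 0 ≤ 1 - c * x / 2 - 2 * c := by nlinarith
    have : 0 ≤ 1 - x := by linarith
    positivity
  nlinarith

/-- The drift inequality of the late phase at the largest admissible speed `(2u - 1) / (2u)`. -/
lemma late_drift_max {u x r s q : ℝ} (hu : 3 / 4 ≤ u) (hu1 : u ≤ 1) (hx0 : 0 ≤ x) (hx1 : x ≤ 1)
    (hr : x ≤ r) (hrs : x ^ 2 ≤ r * s) (hs : 0 ≤ s) (hq : q ≤ x - x ^ 2 / 2) :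
    0 ≤ r * (1 - lateEta u * x + lateC u * (2 * s - q))
      - ((2 * u - 1) / (2 * u) * lateEta' u) * x + ((2 * u - 1) / (2 * u) * lateC' u) * s := by
  have hr0 : 0 ≤ r := hx0.trans hr
  have hu0 : 0 < u := by linarith
  have hv : 0 < 2 * u - 1 := by linarith
  have he : 0 ≤ 4 * u - 3 := by linarith
  have hc : 0 ≤ lateC u := by unfold lateC; positivity
  rcases hx0.eq_or_lt with rfl | hx
  · have hq0 : q ≤ 0 := by simpa using hq
    have h2 : 0 ≤ lateC' u := by
      have : 0 ≤ 1 - u := by linarith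
      unfold lateC'; positivity
    have : 0 ≤ lateC u * (2 * s - q) := mul_nonneg hc (by linarith)
    have : 0 ≤ r * (1 - lateEta u * 0 + lateC u * (2 * s - q)) := mul_nonneg hr0 (by linarith)
    have : 0 ≤ ((2 * u - 1) / (2 * u) * lateC' u) * s := by positivity
    linarith
  have hrpos : 0 < r := hx.trans_le hr
  -- the worst case is `q = x - x² / 2` and `s = x² / r`
  have hs' : x ^ 2 / r ≤ s := by rw [div_le_iff₀ hrpos]; linarith
  have h1 : r * lateC u * q ≤ r * lateC u * (x - x ^ 2 / 2) := by gcongr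
  have h2 : lateC u * x ^ 2 ≤ lateC u * (r * s) := by gcongr
  have e1 : (2 * u - 1) / (2 * u) * lateC' u = 4 * (1 - u) / (3 * u * (2 * u - 1) ^ 2) := by
    unfold lateC'; field_simp; ring
  have h3 : (2 * u - 1) / (2 * u) * lateC' u * (x ^ 2 / r)
      ≤ (2 * u - 1) / (2 * u) * lateC' u * s := by
    have : 0 ≤ (2 * u - 1) / (2 * u) * lateC' u := by
      have : 0 ≤ 1 - u := by linarith
      rw [e1]; positivity
    gcongr
  have key := drift_poly_nonneg (u := u) (σ := u * (r / x)) (y := 1 - x) hu hu1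
    (by
      have : 1 ≤ r / x := by rw [le_div_iff₀ hx]; linarith
      nlinarith) (by linarith)
  have : r * (1 - lateEta u * x - lateC u * (x - x ^ 2 / 2)) + 2 * lateC u * x ^ 2
      - ((2 * u - 1) / (2 * u) * lateEta' u) * x
      + (2 * u - 1) / (2 * u) * lateC' u * (x ^ 2 / r)
      = x ^ 2 / (6 * (2 * u - 1) ^ 2 * u ^ 2 * r) * (8 * u * (1 - u) * (u * (r / x) - 1) ^ 2
      + (u * (r / x)) * (1 - x) * (4 * u * (4 * u - 3) * ((u * (r / x)) - 1)
        + (u * (r / x)) * (4 * u - 3) ^ 2)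
      + (u * (r / x)) ^ 2 * (4 * u - 3) * (1 - x) ^ 2) := by
    unfold lateEta' lateC' lateEta lateC
    obtain ⟨v, rfl⟩ : ∃ v, u = (v + 1) / 2 := ⟨2 * u - 1, by ring⟩
    have e : 2 * ((v + 1) / 2) - 1 = v := by ring
    rw [e] at hv
    have hv1 : 0 < v + 1 := by linarith
    simp only [e]
    field_simp
    ring
  have hpos : 0 ≤ r * (1 - lateEta u * x - lateC u * (x - x ^ 2 / 2)) + 2 * lateC u * x ^ 2
      - ((2 * u - 1) / (2 * u) * lateEta' u) * x
      + (2 * u - 1) / (2 * u) * lateC' u * (x ^ 2 / r) := by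
    rw [this]; positivity
  nlinarith

/-- The drift inequality of the late phase for every admissible speed `w`: it is affine in `w` and
holds at `w = 0` and at the largest admissible speed. -/
lemma late_drift {u w x r s q : ℝ} (hu : 3 / 4 ≤ u) (hu1 : u ≤ 1) (hw : 0 ≤ w)
    (hw1 : w ≤ (2 * u - 1) / (2 * u)) (hx0 : 0 ≤ x) (hx1 : x ≤ 1)
    (hr : x ≤ r) (hrs : x ^ 2 ≤ r * s) (hs : 0 ≤ s) (hq : q ≤ x - x ^ 2 / 2) :
    0 ≤ r * (1 - lateEta u * x + lateC u * (2 * s - q))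
      + (lateEta' u * (-w)) * x - (lateC' u * (-w)) * s := by
  have hr0 : 0 ≤ r := hx0.trans hr
  have hu0 : 0 < u := by linarith
  have hv : 0 < 2 * u - 1 := by linarith
  have he : 0 ≤ 4 * u - 3 := by linarith
  have hu2 : 0 ≤ 1 - u := by linarith
  have hc : 0 ≤ lateC u := by unfold lateC; positivity
  have hmax := late_drift_max hu hu1 hx0 hx1 hr hrs hs hq
  have hη : 0 ≤ lateEta u := by
    have : 0 ≤ 8 * u - 3 := by linarith
    unfold lateEta; positivity
  have hB : 1 - lateEta u - lateC u / 2 = 4 * u * (1 - u) / (3 * (2 * u - 1) ^ 2) := by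
    unfold lateEta lateC
    obtain ⟨v, rfl⟩ : ∃ v, u = (v + 1) / 2 := ⟨2 * u - 1, by ring⟩
    have e : 2 * ((v + 1) / 2) - 1 = v := by ring
    rw [e] at hv
    simp only [e]
    field_simp
    ring
  have hB0 : 0 ≤ 1 - lateEta u - lateC u / 2 := by rw [hB]; positivity
  have h0 : 0 ≤ r * (1 - lateEta u * x + lateC u * (2 * s - q)) := by
    refine mul_nonneg hr0 ?_
    have h1 : lateC u * q ≤ lateC u * (1 / 2) := by
      have : q ≤ 1 / 2 := by nlinarith [sq_nonneg (1 - x)]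
      gcongr
    have h2 : lateEta u * x ≤ lateEta u := mul_le_of_le_one_right hη hx1
    nlinarith [mul_nonneg hc hs]
  rcases le_or_gt 0 (-(lateEta' u) * x + lateC' u * s) with h | h
  · nlinarith [mul_nonneg hw h]
  · have : (2 * u - 1) / (2 * u) * (-(lateEta' u) * x + lateC' u * s)
      ≤ w * (-(lateEta' u) * x + lateC' u * s) := mul_le_mul_of_nonpos_right hw1 h.le
    linarith

/-! ### The converse Jensen inequality and the potential -/

/-- The trapezoidal rule overestimates the integral of the convex function `exp (-t)` over
`[0, l]`. -/
lemma one_sub_exp_neg_le {l : ℝ} (hl : 0 ≤ l) :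
    1 - Real.exp (-l) ≤ l * (1 + Real.exp (-l)) / 2 := by
  have hd : ∀ x : ℝ, HasDerivAt (fun l : ℝ => l * (1 + Real.exp (-l)) / 2 - (1 - Real.exp (-l)))
      ((1 - (1 + x) * Real.exp (-x)) / 2) x := by
    intro x
    have h1 : HasDerivAt (fun l : ℝ => Real.exp (-l)) (-Real.exp (-x)) x := by
      simpa using (hasDerivAt_neg x).exp
    exact ((((hasDerivAt_id x).mul (h1.const_add 1)).div_const 2).sub
      (h1.const_sub 1)).congr_deriv (by simp; ring)
  have hm : MonotoneOn (fun l : ℝ => l * (1 + Real.exp (-l)) / 2 - (1 - Real.exp (-l)))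
      (Set.Ici 0) := by
    refine monotoneOn_of_deriv_nonneg (convex_Ici 0)
      (fun x _ => (hd x).continuousAt.continuousWithinAt)
      (fun x _ => (hd x).differentiableAt.differentiableWithinAt) fun x _ => ?_
    rw [(hd x).deriv]
    have h2 : (1 + x) * Real.exp (-x) ≤ Real.exp x * Real.exp (-x) := by
      gcongr
      linarith [Real.add_one_le_exp x]
    rw [← Real.exp_add, add_neg_cancel, Real.exp_zero] at h2
    linarith
  have := hm (Set.self_mem_Ici) (Set.mem_Ici.2 hl) hl
  norm_num at this
  linarith

/-- The inductive form of `sum_sq_div_le`. The indices are added in decreasing order of the ratio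
`z i / l i`, and `a` is a lower bound on the ratios of those present. Allowing `Y` to exceed
`∑ i ∈ T, z i` as far as the constraint permits accounts for the slack in the constraints of the
sets met on the way. -/
lemma sum_sq_div_add_le {I : Type*} [DecidableEq I] (z l : I → ℝ) (T : Finset I)
    (hl : ∀ i ∈ T, 0 < l i) (hz : ∀ i ∈ T, 0 ≤ z i)
    (h : ∀ S ⊆ T, ∑ i ∈ S, z i ≤ 1 - Real.exp (-∑ i ∈ S, l i)) :
    ∀ a Y : ℝ, 0 ≤ a → (∀ i ∈ T, a ≤ z i / l i) → ∑ i ∈ T, z i ≤ Y →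
      Y ≤ 1 - Real.exp (-∑ i ∈ T, l i) →
      ∑ i ∈ T, z i ^ 2 / l i + 2 * a * (Y - ∑ i ∈ T, z i) ≤ Y - Y ^ 2 / 2 := by
  induction T using Finset.induction_on_min_value (fun i => z i / l i) with
  | empty =>
    intro a Y ha _ hY hY1
    have : Y = 0 := le_antisymm (by simpa using hY1) (by simpa using hY)
    simp [this]
  | insert k T hk hmin ih =>
    intro a Y ha haT hY hY1
    have hlk := hl k (Finset.mem_insert_self k T)
    have hzk := hz k (Finset.mem_insert_self k T)
    rw [Finset.sum_insert hk] at hY hY1 ⊢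
    rw [Finset.sum_insert hk]
    have hY' : ∑ i ∈ T, z i ≤ min Y (1 - Real.exp (-∑ i ∈ T, l i)) :=
      le_min (by linarith) (h T (Finset.subset_insert k T))
    have ih' := ih (fun i hi => hl i (Finset.mem_insert_of_mem hi))
      (fun i hi => hz i (Finset.mem_insert_of_mem hi))
      (fun S hS => h S (hS.trans (Finset.subset_insert k T)))
      (z k / l k) (min Y (1 - Real.exp (-∑ i ∈ T, l i))) (by positivity) hmin hY' (min_le_right _ _)
    obtain ⟨Y', hY'def⟩ : ∃ Y', Y' = min Y (1 - Real.exp (-∑ i ∈ T, l i)) := ⟨_, rfl⟩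
    rw [← hY'def] at ih' hY'
    have hYY' : Y' ≤ Y := hY'def ▸ min_le_left _ _
    -- the increment `Y - Y'` is at most `l k` times the average of `1 - Y` and `1 - Y'`
    have hinc : Y - Y' ≤ l k * (1 - (Y + Y') / 2) := by
      rcases min_choice Y (1 - Real.exp (-∑ i ∈ T, l i)) with hm | hm
      · rw [← hY'def] at hm
        have : Y ≤ 1 := by linarith [Real.exp_pos (-(l k + ∑ i ∈ T, l i))]
        rw [hm]; nlinarith
      · rw [← hY'def] at hm
        have e1 : Real.exp (-(l k + ∑ i ∈ T, l i)) = (1 - Y') * Real.exp (- l k) := by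
          rw [hm, neg_add, Real.exp_add]; ring
        have h1 : (1 - Y') * Real.exp (- l k) ≤ 1 - Y := by linarith
        have h2 := one_sub_exp_neg_le hlk.le
        have h3 : 0 ≤ 1 - Y' := by rw [hm]; simp [Real.exp_nonneg]
        nlinarith [mul_le_mul_of_nonneg_left h2 h3, mul_le_mul_of_nonneg_left h1 hlk.le]
    have hak : a ≤ z k / l k := haT k (Finset.mem_insert_self k T)
    have h1 : 2 * a * (Y - (z k + ∑ i ∈ T, z i))
        ≤ 2 * (z k / l k) * (Y - (z k + ∑ i ∈ T, z i)) := by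
      gcongr
    obtain ⟨p, hp⟩ : ∃ p, p = z k / l k := ⟨_, rfl⟩
    have hzp : z k = p * l k := by rw [hp]; field_simp
    have h2 : z k ^ 2 / l k = p ^ 2 * l k := by rw [hzp]; field_simp
    have h3 : 2 * p * (Y - Y') - p ^ 2 * l k ≤ (Y - Y') * (1 - (Y + Y') / 2) := by
      have h4 : l k * (2 * p * (Y - Y') - p ^ 2 * l k) ≤ l k * ((Y - Y') * (1 - (Y + Y') / 2)) := by
        nlinarith [sq_nonneg ((Y - Y') - p * l k),
          mul_le_mul_of_nonneg_left hinc (sub_nonneg.2 hYY')]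
      exact le_of_mul_le_mul_left h4 hlk
    rw [h2]
    rw [← hp] at h1 ih'
    nlinarith

/-- The converse Jensen inequality for squares: under the constraints of the Natural LP at an
offline vertex of load `X = ∑ z i`, the sum `∑ z i ^ 2 / l i` is at most `X - X ^ 2 / 2`. This is
the integral of `exp (-2t)` over an interval `[0, b]` on which `exp (-t)` has integral `X`, the
limiting case in which the ratios `z i / l i` follow `exp (-t)`. -/
lemma sum_sq_div_le {I : Type*} [DecidableEq I] (z l : I → ℝ) (T : Finset I)
    (hl : ∀ i ∈ T, 0 < l i) (hz : ∀ i ∈ T, 0 ≤ z i)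
    (h : ∀ S ⊆ T, ∑ i ∈ S, z i ≤ 1 - Real.exp (-∑ i ∈ S, l i)) :
    ∑ i ∈ T, z i ^ 2 / l i ≤ ∑ i ∈ T, z i - (∑ i ∈ T, z i) ^ 2 / 2 := by
  simpa using sum_sq_div_add_le z l T hl hz h 0 (∑ i ∈ T, z i) le_rfl
    (fun i hi => div_nonneg (hz i hi) (hl i hi).le) le_rfl (h T subset_rfl)

/-- `η` and `c`, with derivatives `η'` and `c'`, are admissible coefficients on the time interval
`[a, b]` of a potential `η t * L - c t * Q`, where `L` is the fractional mass of the unmatched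
offline vertices and `Q` the energy. The field `drift` says that the expected growth of the
matching makes up for the loss of potential, separately for every unmatched offline vertex: `x` is
its load, `r` the rate at which it gets matched, `s` its share of `Q`, and `2 * s - q` the amount by
which `Q` drops when it gets matched. -/
structure IsPotential (η c η' c' : ℝ → ℝ) (a b : ℝ) : Prop where
  deriv_eta : ∀ t ∈ Set.Icc a b, HasDerivAt η (η' t) t
  deriv_c : ∀ t ∈ Set.Icc a b, HasDerivAt c (c' t) t
  cont_eta : ContinuousOn η' (Set.Icc a b)
  cont_c : ContinuousOn c' (Set.Icc a b)
  drift : ∀ t ∈ Set.Icc a b, ∀ x r s q : ℝ, 0 ≤ x → x ≤ 1 → x ≤ r → x ^ 2 ≤ r * s → 0 ≤ s →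
    s ≤ x → q ≤ x - x ^ 2 / 2 → 0 ≤ r * (1 - η t * x + c t * (2 * s - q)) + η' t * x - c' t * s

/-- The coefficient of the energy in the early phase, which ends at time `401 / 1000`. This time is
long enough for `1 - 3 / 2 * earlyC 0 ≥ 0.707` and leaves enough time for the late phase. -/
def earlyC (t : ℝ) : ℝ := Real.exp (4 / 3 * (t - 401 / 1000)) / 3

lemma hasDerivAt_earlyC (t : ℝ) : HasDerivAt earlyC (4 / 3 * earlyC t) t := by
  have h1 : HasDerivAt (fun t : ℝ => 4 / 3 * (t - 401 / 1000)) (4 / 3) t := by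
    simpa using ((hasDerivAt_id t).sub_const (401 / 1000)).const_mul (4 / 3)
  unfold earlyC
  exact (h1.exp.div_const 3).congr_deriv (by ring)

lemma isPotential_early : IsPotential (fun t => 1 - earlyC t / 2) earlyC
    (fun t => -(2 * earlyC t / 3)) (fun t => 4 * earlyC t / 3) 0 (401 / 1000) where
  deriv_eta t _ := (((hasDerivAt_earlyC t).div_const 2).const_sub 1).congr_deriv (by ring)
  deriv_c t _ := (hasDerivAt_earlyC t).congr_deriv (by ring)
  cont_eta := by unfold earlyC; fun_prop
  cont_c := by unfold earlyC; fun_prop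
  drift t ht x r s q hx hx1 hr hrs _ hsx hq := by
    refine early_drift ?_ ?_ hx hx1 hr hrs hsx hq
    · unfold earlyC; positivity
    · unfold earlyC
      have : Real.exp (4 / 3 * (t - 401 / 1000)) ≤ 1 := Real.exp_le_one_iff.2 (by linarith [ht.2])
      linarith

/-- The variable `u` of the late phase as a function of time. The extremal trajectory
`u' = -(2u - 1) / (2u)` goes from `1` to `3 / 4` in time `1 / 4 + log 2 / 2 < 0.597`; the cubic
polynomial chosen here is slightly slower and takes time `0.599`. -/
def lateVar (t : ℝ) : ℝ :=
  1 - 0.2988 * ((t - 0.401) / 0.599) + 0.0456 * ((t - 0.401) / 0.599) ^ 2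
    + 0.0032 * ((t - 0.401) / 0.599) ^ 3

/-- The speed at which `lateVar` decreases. -/
def lateSpeed (t : ℝ) : ℝ :=
  (0.2988 - 0.0912 * ((t - 0.401) / 0.599) - 0.0096 * ((t - 0.401) / 0.599) ^ 2) / 0.599

lemma hasDerivAt_lateVar (t : ℝ) : HasDerivAt lateVar (-lateSpeed t) t := by
  have h1 : HasDerivAt (fun t : ℝ => (t - 0.401) / 0.599) (1 / 0.599) t := by
    simpa using ((hasDerivAt_id t).sub_const (0.401 : ℝ)).div_const (0.599)
  unfold lateVar lateSpeed
  exact ((((h1.const_mul (0.2988 : ℝ)).const_sub 1).add ((h1.fun_pow 2).const_mul (0.0456 : ℝ))).add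
    ((h1.fun_pow 3).const_mul (0.0032 : ℝ))).congr_deriv (by push_cast; ring)

lemma lateVar_mem {t : ℝ} (ht : t ∈ Set.Icc (401 / 1000 : ℝ) 1) :
    3 / 4 ≤ lateVar t ∧ lateVar t ≤ 1 := by
  obtain ⟨s, hs⟩ : ∃ s, s = (t - 0.401) / 0.599 := ⟨_, rfl⟩
  have h0 : 0 ≤ s := by rw [hs]; apply div_nonneg <;> norm_num; linarith [ht.1]
  have h1 : s ≤ 1 := by rw [hs, div_le_one (by norm_num)]; norm_num; linarith [ht.2]
  unfold lateVar
  rw [← hs]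
  have h2 : 0 ≤ s * (1 - s) := mul_nonneg h0 (by linarith)
  constructor
  · nlinarith [mul_nonneg h2 h0]
  · nlinarith [mul_nonneg h2 h0]

lemma lateSpeed_mem {t : ℝ} (ht : t ∈ Set.Icc (401 / 1000 : ℝ) 1) :
    0 ≤ lateSpeed t ∧ lateSpeed t ≤ (2 * lateVar t - 1) / (2 * lateVar t) := by
  have hu := (lateVar_mem ht).1
  rw [le_div_iff₀ (by linarith)]
  obtain ⟨s, hs⟩ : ∃ s, s = (t - 0.401) / 0.599 := ⟨_, rfl⟩
  have h0 : 0 ≤ s := by rw [hs]; apply div_nonneg <;> norm_num; linarith [ht.1]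
  have h1 : s ≤ 1 := by rw [hs, div_le_one (by norm_num)]; norm_num; linarith [ht.2]
  unfold lateSpeed lateVar
  rw [← hs]
  refine ⟨div_nonneg (by nlinarith) (by norm_num), ?_⟩
  rw [div_mul_eq_mul_div, div_le_iff₀ (by norm_num)]
  have h2 : 0 ≤ 1 - s := by linarith
  -- the Bernstein coefficients of the difference of the two sides are all positive
  have : 0 ≤ 7 / 5000 * (1 - s) ^ 5 + 62503 / 6250000 * s * (1 - s) ^ 4
      + 56497 / 3125000 * s ^ 2 * (1 - s) ^ 3 + 199 / 15625 * s ^ 3 * (1 - s) ^ 2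
      + 89 / 15625 * s ^ 4 * (1 - s) + 1 / 400 * s ^ 5 := by positivity
  linear_combination this

lemma isPotential_late : IsPotential (fun t => lateEta (lateVar t)) (fun t => lateC (lateVar t))
    (fun t => lateEta' (lateVar t) * -lateSpeed t) (fun t => lateC' (lateVar t) * -lateSpeed t)
    (401 / 1000) 1 where
  deriv_eta t ht := (hasDerivAt_lateEta (lateVar_mem ht).1).comp t (hasDerivAt_lateVar t)
  deriv_c t ht := (hasDerivAt_lateC (lateVar_mem ht).1).comp t (hasDerivAt_lateVar t)
  cont_eta := by
    have h1 : ContinuousOn lateVar (Set.Icc (401 / 1000) 1) :=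
      fun t _ => (hasDerivAt_lateVar t).continuousAt.continuousWithinAt
    have h2 : Continuous lateSpeed := by unfold lateSpeed; fun_prop
    unfold lateEta'
    refine ContinuousOn.mul (ContinuousOn.div (by fun_prop) (by fun_prop) fun t ht => ?_)
      h2.neg.continuousOn
    have := (lateVar_mem ht).1
    have : 0 < 2 * lateVar t - 1 := by linarith
    positivity
  cont_c := by
    have h1 : ContinuousOn lateVar (Set.Icc (401 / 1000) 1) :=
      fun t _ => (hasDerivAt_lateVar t).continuousAt.continuousWithinAt
    have h2 : Continuous lateSpeed := by unfold lateSpeed; fun_prop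
    unfold lateC'
    refine ContinuousOn.mul (ContinuousOn.div (by fun_prop) (by fun_prop) fun t ht => ?_)
      h2.neg.continuousOn
    have := (lateVar_mem ht).1
    have : 0 < 2 * lateVar t - 1 := by linarith
    positivity
  drift t ht x r s q hx hx1 hr hrs hs _ hq :=
    late_drift (lateVar_mem ht).1 (lateVar_mem ht).2 (lateSpeed_mem ht).1 (lateSpeed_mem ht).2
      hx hx1 hr hrs hs hq

lemma late_start : lateEta (lateVar (401 / 1000)) = 1 - earlyC (401 / 1000) / 2 ∧
    lateC (lateVar (401 / 1000)) = earlyC (401 / 1000) := by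
  unfold lateEta lateC lateVar earlyC
  norm_num

lemma late_end : lateEta (lateVar 1) = 0 ∧ lateC (lateVar 1) = 0 := by
  unfold lateEta lateC lateVar
  norm_num

lemma early_start : (0.707 : ℝ) ≤ 1 - earlyC 0 / 2 - earlyC 0 := by
  unfold earlyC
  have h1 : Real.exp (4 / 3 * (0 - 401 / 1000)) ≤ 0.586 := by
    rw [show (4 / 3 * (0 - 401 / 1000) : ℝ) = -(1604 / 3000) by norm_num, Real.exp_neg,
      inv_le_comm₀ (Real.exp_pos _) (by norm_num)]
    refine le_trans ?_ (Real.sum_le_exp_of_nonneg (by norm_num) 7)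
    norm_num [Finset.sum_range_succ, Nat.factorial]
  linarith

/-! ### The Markov process of the matched vertices -/

namespace StochasticMatching

set_option linter.unusedSectionVars false

variable {I J : Type*} [Fintype I] [Fintype J] [DecidableEq I] [DecidableEq J]

/-- The fractional matching `x`, extended by zero to the pairs that are not edges. -/
def weight (G : StochasticMatching I J) (x : I → J → ℝ) (i : I) (j : J) : ℝ :=
  if (i, j) ∈ G.edges then x i j else 0

/-- The fractional mass at the online type `i` of the offline vertices outside `M`. -/
def residual (G : StochasticMatching I J) (x : I → J → ℝ) (M : Finset J) (i : I) : ℝ :=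
  ∑ j ∈ Mᶜ, G.weight x i j

/-- The fractional mass at the offline vertex `j`. -/
def load (G : StochasticMatching I J) (x : I → J → ℝ) (j : J) : ℝ := ∑ i, G.weight x i j

/-- The expected change of `f`, a function of the set of matched offline vertices, that is caused
by an arrival of type `i`. -/
def arrivalDrift (G : StochasticMatching I J) (x : I → J → ℝ) (f : Finset J → ℝ) (M : Finset J)
    (i : I) : ℝ :=
  ∑ j ∈ Mᶜ, G.weight x i j / G.residual x M i * (f (insert j M) - f M)

/-- The generator of the Markov process of the set of matched offline vertices. -/
def generator (G : StochasticMatching I J) (x : I → J → ℝ) (f : Finset J → ℝ) (M : Finset J) : ℝ :=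
  ∑ i, (G.rate i : ℝ) * G.arrivalDrift x f M i

/-- The fractional mass of the unmatched offline vertices. -/
def massLeft (G : StochasticMatching I J) (x : I → J → ℝ) (M : Finset J) : ℝ :=
  ∑ j ∈ Mᶜ, G.load x j

/-- The energy of the unmatched offline vertices. By the Cauchy–Schwarz inequality the matching
grows at a rate of at least `massLeft ^ 2 / energy`, so that a small energy is good. -/
def energy (G : StochasticMatching I J) (x : I → J → ℝ) (M : Finset J) : ℝ :=
  ∑ i, G.residual x M i ^ 2 / (G.rate i : ℝ)

/-- The expectation of `f` at the set of matched offline vertices after Stochastic SWOR, started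
with matched set `M`, has processed the arrivals `w`. -/
def runExp (G : StochasticMatching I J) (x : I → J → ℝ) (f : Finset J → ℝ) (M : Finset J)
    (w : List I) : ℝ :=
  ∑ M', (G.sworRun x M w M').toReal * f M'

variable {G : StochasticMatching I J} {x : I → J → ℝ}

lemma weight_nonneg (hx : G.LPFeasible x) (i : I) (j : J) : 0 ≤ G.weight x i j := by
  unfold weight
  split_ifs with h
  · exact hx.nonneg _ h
  · exact le_rfl

lemma residual_nonneg (hx : G.LPFeasible x) (M : Finset J) (i : I) : 0 ≤ G.residual x M i :=
  Finset.sum_nonneg fun j _ => weight_nonneg hx i j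

lemma residual_le_rate (hx : G.LPFeasible x) (M : Finset J) (i : I) :
    G.residual x M i ≤ G.rate i := by
  refine le_trans ?_ (hx.online i)
  unfold residual offlineNbrs
  rw [Finset.sum_filter]
  exact Finset.sum_le_univ_sum_of_nonneg fun j => weight_nonneg hx i j

lemma sum_weight_eq (G : StochasticMatching I J) (x : I → J → ℝ) (j : J) :
    ∑ i ∈ G.onlineNbrs j, x i j = G.load x j := by
  unfold load weight onlineNbrs
  rw [Finset.sum_filter]

lemma load_nonneg (hx : G.LPFeasible x) (j : J) : 0 ≤ G.load x j :=
  Finset.sum_nonneg fun i _ => weight_nonneg hx i j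

lemma load_le_one (hx : G.LPFeasible x) (j : J) : G.load x j ≤ 1 := by
  rw [← sum_weight_eq]
  refine (hx.offline j _ subset_rfl).trans ?_
  linarith [Real.exp_pos (-∑ i ∈ G.onlineNbrs j, (G.rate i : ℝ))]

lemma sum_sq_weight_div_le (hx : G.LPFeasible x) (j : J) :
    ∑ i, G.weight x i j ^ 2 / (G.rate i : ℝ) ≤ G.load x j - G.load x j ^ 2 / 2 := by
  have h := sum_sq_div_le (fun i => x i j) (fun i => (G.rate i : ℝ)) (G.onlineNbrs j)
    (fun i _ => by exact_mod_cast G.rate_pos i)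
    (fun i hi => hx.nonneg (i, j) (by simpa [onlineNbrs] using hi)) (hx.offline j)
  rw [sum_weight_eq] at h
  refine le_trans (le_of_eq ?_) h
  unfold weight onlineNbrs
  rw [Finset.sum_filter]
  refine Finset.sum_congr rfl fun i _ => ?_
  split_ifs <;> simp

lemma weight_eq_zero_of_residual (hx : G.LPFeasible x) {M : Finset J} {i : I} {j : J} (hj : j ∉ M)
    (h : G.residual x M i = 0) : G.weight x i j = 0 :=
  (Finset.sum_eq_zero_iff_of_nonneg fun j _ => weight_nonneg hx i j).1 h j (by simpa using hj)

lemma residual_insert {M : Finset J} {j : J} (hj : j ∉ M) (i : I) :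
    G.residual x (insert j M) i = G.residual x M i - G.weight x i j := by
  unfold residual
  rw [Finset.compl_insert, Finset.sum_erase_eq_sub (by simpa using hj)]

lemma massLeft_insert {M : Finset J} {j : J} (hj : j ∉ M) :
    G.massLeft x (insert j M) = G.massLeft x M - G.load x j := by
  unfold massLeft
  rw [Finset.compl_insert, Finset.sum_erase_eq_sub (by simpa using hj)]

lemma energy_insert {M : Finset J} {j : J} (hj : j ∉ M) :
    G.energy x (insert j M) = G.energy x M
      - (2 * ∑ i, G.weight x i j * G.residual x M i / (G.rate i : ℝ)
        - ∑ i, G.weight x i j ^ 2 / (G.rate i : ℝ)) := by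
  unfold energy
  rw [Finset.mul_sum, ← Finset.sum_sub_distrib, ← Finset.sum_sub_distrib]
  refine Finset.sum_congr rfl fun i _ => ?_
  rw [residual_insert hj]
  ring

lemma sum_weight_residual (M : Finset J) :
    ∑ j ∈ Mᶜ, ∑ i, G.weight x i j * G.residual x M i / (G.rate i : ℝ) = G.energy x M := by
  rw [Finset.sum_comm]
  unfold energy
  refine Finset.sum_congr rfl fun i _ => ?_
  rw [← Finset.sum_div, ← Finset.sum_mul, sq]
  rfl

lemma generator_eq (f : Finset J → ℝ) (M : Finset J) :
    G.generator x f M = ∑ j ∈ Mᶜ,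
      (∑ i, (G.rate i : ℝ) * (G.weight x i j / G.residual x M i)) * (f (insert j M) - f M) := by
  unfold generator arrivalDrift
  simp_rw [Finset.mul_sum, Finset.sum_mul]
  rw [Finset.sum_comm]
  simp_rw [mul_assoc]

lemma rate_pos_real (G : StochasticMatching I J) (i : I) : (0 : ℝ) < G.rate i := by
  exact_mod_cast G.rate_pos i

/-- An unmatched vertex `j` gets matched at a rate at least `load j`. -/
lemma load_le_hazard (hx : G.LPFeasible x) {M : Finset J} {j : J} (hj : j ∉ M) :
    G.load x j ≤ ∑ i, (G.rate i : ℝ) * (G.weight x i j / G.residual x M i) := by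
  refine Finset.sum_le_sum fun i _ => ?_
  rcases (residual_nonneg hx M i).eq_or_lt with h | h
  · simp [weight_eq_zero_of_residual hx hj h.symm]
  · rw [mul_div_assoc', le_div_iff₀ h, mul_comm]
    exact mul_le_mul_of_nonneg_right (residual_le_rate hx M i) (weight_nonneg hx i j)

/-- The Cauchy–Schwarz inequality relating the rate at which an unmatched vertex gets matched to its
share of the energy. -/
lemma load_sq_le (hx : G.LPFeasible x) {M : Finset J} {j : J} (hj : j ∉ M) :
    G.load x j ^ 2 ≤ (∑ i, (G.rate i : ℝ) * (G.weight x i j / G.residual x M i))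
      * ∑ i, G.weight x i j * G.residual x M i / (G.rate i : ℝ) := by
  refine Finset.sum_sq_le_sum_mul_sum_of_sq_le_mul _ (fun i _ => ?_) (fun i _ => ?_) fun i _ => ?_
  · exact mul_nonneg (NNReal.coe_nonneg _)
      (div_nonneg (weight_nonneg hx i j) (residual_nonneg hx M i))
  · exact div_nonneg (mul_nonneg (weight_nonneg hx i j) (residual_nonneg hx M i))
      (NNReal.coe_nonneg _)
  · have := rate_pos_real G i
    rcases (residual_nonneg hx M i).eq_or_lt with h | h
    · simp [weight_eq_zero_of_residual hx hj h.symm]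
    · exact le_of_eq (by field_simp)

lemma sum_weight_residual_nonneg (hx : G.LPFeasible x) (M : Finset J) (j : J) :
    0 ≤ ∑ i, G.weight x i j * G.residual x M i / (G.rate i : ℝ) :=
  Finset.sum_nonneg fun i _ => div_nonneg
    (mul_nonneg (weight_nonneg hx i j) (residual_nonneg hx M i)) (NNReal.coe_nonneg _)

lemma sum_weight_residual_le (hx : G.LPFeasible x) (M : Finset J) (j : J) :
    ∑ i, G.weight x i j * G.residual x M i / (G.rate i : ℝ) ≤ G.load x j := by
  refine Finset.sum_le_sum fun i _ => ?_
  rw [div_le_iff₀ (rate_pos_real G i)]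
  exact mul_le_mul_of_nonneg_left (residual_le_rate hx M i) (weight_nonneg hx i j)

/-- The size of the matching plus the potential with coefficients `a` and `b`. -/
def boosted (G : StochasticMatching I J) (x : I → J → ℝ) (a b : ℝ) (M : Finset J) : ℝ :=
  M.card + a * G.massLeft x M - b * G.energy x M

/-- The size of the matching plus a potential with admissible coefficients is a submartingale, in
infinitesimal form. -/
lemma generator_boosted_nonneg (hx : G.LPFeasible x) {η c η' c' : ℝ → ℝ} {a b t : ℝ}
    (hp : IsPotential η c η' c' a b) (ht : t ∈ Set.Icc a b) (M : Finset J) :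
    0 ≤ G.generator x (G.boosted x (η t) (c t)) M + η' t * G.massLeft x M
      - c' t * G.energy x M := by
  rw [generator_eq, ← sum_weight_residual M, massLeft, Finset.mul_sum, Finset.mul_sum,
    ← Finset.sum_add_distrib, ← Finset.sum_sub_distrib]
  refine Finset.sum_nonneg fun j hj => ?_
  have hj' : j ∉ M := by simpa using hj
  refine (hp.drift t ht _ _ _ _ (load_nonneg hx j) (load_le_one hx j) (load_le_hazard hx hj')
    (load_sq_le hx hj') (sum_weight_residual_nonneg hx M j) (sum_weight_residual_le hx M j)
    (sum_sq_weight_div_le hx j)).trans_eq ?_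
  unfold boosted
  rw [massLeft_insert hj', energy_insert hj', Finset.card_insert_of_notMem hj']
  push_cast
  ring

/-- The expectation of `f` after a time slot in which, for every type `i`, a single vertex of type
`i` arrives with probability `δ * rate i`, and none arrives otherwise. -/
def slotOp (G : StochasticMatching I J) (x : I → J → ℝ) (δ : ℝ) (f : Finset J → ℝ)
    (M : Finset J) : ℝ :=
  f M + δ * G.generator x f M

lemma sum_weight_div_residual_le (M : Finset J) (i : I) :
    ∑ j ∈ Mᶜ, G.weight x i j / G.residual x M i ≤ 1 := by
  rw [← Finset.sum_div]
  exact div_self_le_one _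

lemma slotOp_mono (hx : G.LPFeasible x) {δ : ℝ} (hδ : 0 ≤ δ) (hδ1 : δ * ∑ i, (G.rate i : ℝ) ≤ 1)
    {f g : Finset J → ℝ} (h : ∀ M, f M ≤ g M) (M : Finset J) :
    G.slotOp x δ f M ≤ G.slotOp x δ g M := by
  have h1 : G.generator x f M - G.generator x g M ≤ (∑ i, (G.rate i : ℝ)) * (g M - f M) := by
    unfold generator
    rw [← Finset.sum_sub_distrib, Finset.sum_mul]
    refine Finset.sum_le_sum fun i _ => ?_
    rw [← mul_sub]
    refine mul_le_mul_of_nonneg_left ?_ (NNReal.coe_nonneg _)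
    unfold arrivalDrift
    rw [← Finset.sum_sub_distrib]
    calc _ ≤ ∑ j ∈ Mᶜ, G.weight x i j / G.residual x M i * (g M - f M) := by
          refine Finset.sum_le_sum fun j _ => ?_
          rw [← mul_sub]
          refine mul_le_mul_of_nonneg_left ?_
            (div_nonneg (weight_nonneg hx i j) (residual_nonneg hx M i))
          linarith [h (insert j M)]
      _ ≤ 1 * (g M - f M) := by
          rw [← Finset.sum_mul]
          exact mul_le_mul_of_nonneg_right (sum_weight_div_residual_le M i)
            (sub_nonneg.2 (h M))
      _ = _ := one_mul _
  unfold slotOp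
  nlinarith [mul_le_mul_of_nonneg_left h1 hδ, mul_le_mul_of_nonneg_right hδ1 (sub_nonneg.2 (h M))]

lemma slotOp_sub_const (δ κ : ℝ) (f : Finset J → ℝ) (M : Finset J) :
    G.slotOp x δ (fun M => f M - κ) M = G.slotOp x δ f M - κ := by
  unfold slotOp generator arrivalDrift
  simp only [sub_sub_sub_cancel_right]
  ring

lemma toReal_bind {α β : Type*} [Fintype α] (p : PMF α) (q : α → PMF β) (b : β) :
    ((p.bind q) b).toReal = ∑ a, (p a).toReal * (q a b).toReal := by
  rw [PMF.bind_apply, tsum_fintype, ENNReal.toReal_sum]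
  · simp_rw [ENNReal.toReal_mul]
  · intro a _
    exact ENNReal.mul_ne_top (PMF.apply_ne_top _ _) (PMF.apply_ne_top _ _)

/-- The expectation of `g` after one arrival of type `i`. -/
lemma sum_sworDecision (hx : G.LPFeasible x) (M : Finset J) (i : I) (g : Finset J → ℝ) :
    ∑ d, (G.sworDecision x M i d).toReal * g (M ∪ d.toFinset) = g M + G.arrivalDrift x g M i := by
  classical
  have hmass : ∀ j, G.sworMass x M i j
      = ENNReal.ofReal (if j ∈ Mᶜ then G.weight x i j else 0) := by
    intro j
    unfold sworMass weight offlineNbrs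
    by_cases h1 : j ∈ M <;> by_cases h2 : (i, j) ∈ G.edges <;> simp [h1, h2]
  have hnn : ∀ j, 0 ≤ if j ∈ Mᶜ then G.weight x i j else 0 := fun j => by
    split_ifs
    · exact weight_nonneg hx i j
    · exact le_rfl
  have htot : ∑' j, G.sworMass x M i j = ENNReal.ofReal (G.residual x M i) := by
    rw [tsum_fintype]
    simp_rw [hmass]
    rw [← ENNReal.ofReal_sum_of_nonneg fun j _ => hnn j, Finset.sum_ite_mem, Finset.univ_inter]
    rfl
  rw [Fintype.sum_option]
  unfold sworDecision
  split_ifs with h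
  · have hpos : 0 < G.residual x M i := by
      rw [htot] at h
      simpa using h
    have hnone : (PMF.map some (PMF.normalize (G.sworMass x M i) h (by
        rw [htot]; exact ENNReal.ofReal_ne_top)) : PMF (Option J)) none = 0 := by
      rw [PMF.apply_eq_zero_iff]
      simp
    have hsome : ∀ j, ((PMF.map some (PMF.normalize (G.sworMass x M i) h (by
        rw [htot]; exact ENNReal.ofReal_ne_top)) : PMF (Option J)) (some j)).toReal
        = if j ∈ Mᶜ then G.weight x i j / G.residual x M i else 0 := by
      intro j
      rw [PMF.map_apply, tsum_eq_single j]
      · rw [if_pos rfl, PMF.normalize_apply, htot, hmass, ENNReal.toReal_mul,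
          ENNReal.toReal_inv, ENNReal.toReal_ofReal hpos.le, ENNReal.toReal_ofReal (hnn j)]
        split_ifs
        · rfl
        · simp
      · intro b hb
        rw [if_neg]
        simpa using hb.symm
    rw [hnone]
    simp_rw [hsome]
    have hone : ∑ j ∈ Mᶜ, G.weight x i j / G.residual x M i = 1 := by
      rw [← Finset.sum_div]
      exact div_self hpos.ne'
    simp only [ENNReal.toReal_zero, zero_mul, zero_add, ite_mul, Finset.sum_ite_mem,
      Finset.univ_inter]
    unfold arrivalDrift
    simp_rw [mul_sub, Finset.sum_sub_distrib, ← Finset.sum_mul, hone]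
    rw [one_mul, add_sub_cancel]
    refine Finset.sum_congr rfl fun j _ => ?_
    congr 2
    ext k
    simp
  · have h0 : G.residual x M i = 0 := by
      rw [htot] at h
      exact le_antisymm (by simpa using h) (residual_nonneg hx M i)
    simp [arrivalDrift, h0]

lemma runExp_cons (hx : G.LPFeasible x) (f : Finset J → ℝ) (M : Finset J) (i : I) (w : List I) :
    G.runExp x f M (i :: w) = G.runExp x f M w
      + G.arrivalDrift x (fun M => G.runExp x f M w) M i := by
  rw [← sum_sworDecision hx M i (fun M => G.runExp x f M w)]
  unfold runExp
  simp_rw [sworRun, toReal_bind, Finset.sum_mul, Finset.mul_sum]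
  rw [Finset.sum_comm]
  simp_rw [mul_assoc]

lemma runExp_nil (f : Finset J → ℝ) (M : Finset J) : G.runExp x f M [] = f M := by
  classical
  unfold runExp sworRun
  rw [Finset.sum_eq_single M]
  · simp
  · intro b _ hb
    simp [hb]
  · simp

end StochasticMatching

/-! ### Backward induction over time slots -/

/-- The first-order expansion of a continuously differentiable function at the right endpoint of a
short interval is uniform on compact intervals. -/
lemma exists_forall_abs_sub_le {f f' : ℝ → ℝ} {a b : ℝ}
    (hf : ∀ t ∈ Set.Icc a b, HasDerivAt f (f' t) t) (hc : ContinuousOn f' (Set.Icc a b))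
    {ε : ℝ} (hε : 0 < ε) :
    ∃ d > 0, ∀ s t, a ≤ s → s ≤ t → t ≤ b → t - s < d →
      |f t - f s - (t - s) * f' t| ≤ ε * (t - s) := by
  have hu := isCompact_Icc.uniformContinuousOn_of_continuous hc
  obtain ⟨d, hd, h⟩ := Metric.uniformContinuousOn_iff.1 hu ε hε
  refine ⟨d, hd, fun s t has hst htb hd' => ?_⟩
  rcases hst.eq_or_lt with rfl | hlt
  · simp
  obtain ⟨z, hz, hzeq⟩ := exists_hasDerivAt_eq_slope f f' hlt
    (fun x hx => (hf x ⟨has.trans hx.1, hx.2.trans htb⟩).continuousAt.continuousWithinAt)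
    (fun x hx => hf x ⟨has.trans hx.1.le, hx.2.le.trans htb⟩)
  have hts : 0 < t - s := by linarith
  have h1 : f t - f s = f' z * (t - s) := by rw [hzeq]; field_simp
  have h2 := h z ⟨has.trans hz.1.le, hz.2.le.trans htb⟩ t ⟨has.trans hst, htb⟩ (by
    rw [Real.dist_eq, abs_sub_comm, abs_of_pos (by linarith [hz.2])]
    linarith [hz.1])
  rw [Real.dist_eq] at h2
  rw [h1, show f' z * (t - s) - (t - s) * f' t = (f' z - f' t) * (t - s) by ring, abs_mul,
    abs_of_pos hts]
  gcongr

namespace StochasticMatching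

set_option linter.unusedSectionVars false

variable {I J : Type*} [Fintype I] [Fintype J] [DecidableEq I] [DecidableEq J]
variable {G : StochasticMatching I J} {x : I → J → ℝ}

lemma arrivalDrift_sum {α : Type*} (s : Finset α) (a : α → ℝ) (f : α → Finset J → ℝ)
    (M : Finset J) (i : I) :
    G.arrivalDrift x (fun M => ∑ v ∈ s, a v * f v M) M i
      = ∑ v ∈ s, a v * G.arrivalDrift x (f v) M i := by
  unfold arrivalDrift
  simp_rw [Finset.mul_sum]
  rw [Finset.sum_comm]
  refine Finset.sum_congr rfl fun j _ => ?_
  rw [← Finset.sum_sub_distrib, Finset.mul_sum]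
  exact Finset.sum_congr rfl fun v _ => by ring

/-- If the letters of `n` slots are independent with distribution `p`, then the expectation of `f`
after Stochastic SWOR has processed them is given by the iterates of `slotOp`. -/
lemma sum_slots (hx : G.LPFeasible x) {δ : ℝ} {p : Option I → ℝ}
    (hsome : ∀ i, p (some i) = δ * G.rate i) (hsum : ∑ o, p o = 1) (f : Finset J → ℝ) (n : ℕ) :
    ∀ M, ∑ v : Fin n → Option I, (∏ k, p (v k)) * G.runExp x f M (List.ofFn v).reduceOption
      = (G.slotOp x δ)^[n] f M := by
  induction n with
  | zero => intro M; simp [runExp_nil]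
  | succ n ih =>
    intro M
    have hf : (G.slotOp x δ)^[n] f = fun M => ∑ v : Fin n → Option I,
        (∏ k, p (v k)) * G.runExp x f M (List.ofFn v).reduceOption := funext fun M => (ih M).symm
    rw [Function.iterate_succ_apply', hf, ← (Fin.consEquiv fun _ => Option I).sum_comp,
      Fintype.sum_prod_type]
    have e1 : ∀ (o : Option I) (v : Fin n → Option I),
        (Fin.consEquiv fun _ => Option I) (o, v) = Fin.cons o v := fun _ _ => rfl
    simp_rw [e1, Fin.prod_univ_succ, Fin.cons_zero, Fin.cons_succ, List.ofFn_succ, Fin.cons_zero,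
      Fin.cons_succ]
    rw [Fintype.sum_option]
    simp_rw [List.reduceOption_cons_of_none, List.reduceOption_cons_of_some, runExp_cons hx,
      mul_add, Finset.sum_add_distrib, mul_assoc, ← Finset.mul_sum]
    rw [← add_assoc, ← Finset.sum_mul, ← add_mul, ← Fintype.sum_option, hsum, one_mul]
    unfold slotOp generator
    rw [Finset.mul_sum]
    congr 1
    refine Finset.sum_congr rfl fun i _ => ?_
    rw [arrivalDrift_sum, hsome, mul_assoc]

lemma massLeft_le_card (hx : G.LPFeasible x) (M : Finset J) :
    G.massLeft x M ≤ Fintype.card J := by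
  unfold massLeft
  calc _ ≤ ∑ j ∈ Mᶜ, (1 : ℝ) := Finset.sum_le_sum fun j _ => load_le_one hx j
    _ = (Mᶜ.card : ℝ) := by simp
    _ ≤ _ := by exact_mod_cast Finset.card_le_univ _

lemma energy_le_massLeft (hx : G.LPFeasible x) (M : Finset J) :
    G.energy x M ≤ G.massLeft x M := by
  rw [← sum_weight_residual]
  exact Finset.sum_le_sum fun j _ => sum_weight_residual_le hx M j

lemma energy_nonneg (M : Finset J) : 0 ≤ G.energy x M :=
  Finset.sum_nonneg fun _ _ => div_nonneg (sq_nonneg _) (NNReal.coe_nonneg _)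

lemma massLeft_empty : G.massLeft x ∅ = G.lpValue x := by
  unfold massLeft load lpValue weight
  rw [Finset.compl_empty, Finset.sum_comm, ← Finset.sum_product' (f := fun i j =>
    if (i, j) ∈ G.edges then x i j else 0), Finset.univ_product_univ]
  simp

/-- For `n` slots, the number `δ` such that a slot holds exactly one arrival, and this arrival is of
type `i`, with probability `δ * rate i`. It is the length of a slot up to second order. -/
def slotRate (G : StochasticMatching I J) (n : ℕ) : ℝ :=
  (n : ℝ)⁻¹ * Real.exp (-((n : ℝ)⁻¹ * ∑ i, (G.rate i : ℝ)))

lemma slotRate_nonneg (n : ℕ) : 0 ≤ G.slotRate n := by unfold slotRate; positivity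

lemma slotRate_mul_le (n : ℕ) : G.slotRate n * ∑ i, (G.rate i : ℝ) ≤ 1 := by
  unfold slotRate
  obtain ⟨z, hz⟩ : ∃ z, z = (n : ℝ)⁻¹ * ∑ i, (G.rate i : ℝ) := ⟨_, rfl⟩
  rw [← hz, mul_right_comm, ← hz]
  have h1 : z * Real.exp (-z) ≤ Real.exp z * Real.exp (-z) := by
    gcongr
    linarith [Real.add_one_le_exp z]
  rwa [← Real.exp_add, add_neg_cancel, Real.exp_zero] at h1

lemma slotRate_close (n : ℕ) :
    G.slotRate n ≤ (n : ℝ)⁻¹ ∧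
      (n : ℝ)⁻¹ - G.slotRate n ≤ (n : ℝ)⁻¹ * ((n : ℝ)⁻¹ * ∑ i, (G.rate i : ℝ)) := by
  unfold slotRate
  obtain ⟨z, hz⟩ : ∃ z, z = (n : ℝ)⁻¹ * ∑ i, (G.rate i : ℝ) := ⟨_, rfl⟩
  have hz0 : 0 ≤ z := by rw [hz]; positivity
  rw [← hz]
  have h1 : Real.exp (-z) ≤ 1 := Real.exp_le_one_iff.2 (by linarith)
  have h2 : 1 - z ≤ Real.exp (-z) := by linarith [Real.add_one_le_exp (-z)]
  have hn : 0 ≤ (n : ℝ)⁻¹ := by positivity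
  constructor <;> nlinarith

/-- One slot of backward induction: the boosted size of the matching decreases in expectation by
`o(1 / n)` at most. -/
lemma exists_slotOp_boosted_ge (hx : G.LPFeasible x) {η c η' c' : ℝ → ℝ} {a b : ℝ}
    (hp : IsPotential η c η' c' a b) {ε : ℝ} (hε : 0 < ε) :
    ∃ n₀ : ℕ, ∀ n : ℕ, n₀ ≤ n → ∀ s t : ℝ, a ≤ s → t ≤ b → t = s + (n : ℝ)⁻¹ → ∀ M,
      G.boosted x (η s) (c s) M - ε * (n : ℝ)⁻¹
        ≤ G.slotOp x (G.slotRate n) (G.boosted x (η t) (c t)) M := by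
  obtain ⟨K, hK⟩ : ∃ K : ℝ, K = Fintype.card J + 1 := ⟨_, rfl⟩
  have hK0 : 0 < K := by rw [hK]; positivity
  obtain ⟨Λ, hΛ⟩ : ∃ Λ : ℝ, Λ = ∑ i, (G.rate i : ℝ) := ⟨_, rfl⟩
  have hΛ0 : 0 ≤ Λ := by rw [hΛ]; positivity
  -- each of the four error terms `k1`, …, `k4` below gets a quarter of `ε * δ`
  obtain ⟨d1, hd1, h1⟩ := exists_forall_abs_sub_le hp.deriv_eta hp.cont_eta
    (show 0 < ε / (4 * K) by positivity)
  obtain ⟨d2, hd2, h2⟩ := exists_forall_abs_sub_le hp.deriv_c hp.cont_c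
    (show 0 < ε / (4 * K) by positivity)
  obtain ⟨B1, hB1⟩ := isCompact_Icc.exists_bound_of_continuousOn hp.cont_eta
  obtain ⟨B2, hB2⟩ := isCompact_Icc.exists_bound_of_continuousOn hp.cont_c
  obtain ⟨B, hB⟩ : ∃ B, B = max (max B1 B2) 1 := ⟨_, rfl⟩
  have hBpos : 0 < B := by rw [hB]; positivity
  have htend : Filter.Tendsto (fun n : ℕ => (n : ℝ)⁻¹) Filter.atTop (nhds 0) :=
    tendsto_inv_atTop_nhds_zero_nat
  have hev := htend.eventually (gt_mem_nhds (show 0 < min (min d1 d2) (ε / (4 * K * B * (Λ + 1)))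
    by positivity))
  obtain ⟨n₀, hn₀⟩ := Filter.eventually_atTop.1 hev
  refine ⟨n₀, fun n hn s t has htb hts M => ?_⟩
  have hlt := hn₀ n hn
  obtain ⟨δ, hδ⟩ : ∃ δ, δ = (n : ℝ)⁻¹ := ⟨_, rfl⟩
  have hδ0 : 0 ≤ δ := by rw [hδ]; positivity
  obtain ⟨hc1, hc2⟩ := slotRate_close (G := G) n
  have hr0 := slotRate_nonneg (G := G) n
  rw [← hδ] at hlt hts hc1 hc2
  rw [← hΛ] at hc2
  rw [← hδ]
  obtain ⟨r, hr⟩ : ∃ r, r = G.slotRate n := ⟨_, rfl⟩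
  rw [← hr] at hc1 hc2 hr0
  rw [← hr]
  have hδd : δ < d1 ∧ δ < d2 ∧ δ < ε / (4 * K * B * (Λ + 1)) := by
    simpa [and_assoc] using hlt
  have ht : t ∈ Set.Icc a b := ⟨by linarith, htb⟩
  have e1 := h1 s t has (by linarith) htb (by linarith [hδd.1])
  have e2 := h2 s t has (by linarith) htb (by linarith [hδd.2.1])
  have ets : t - s = δ := by linarith
  rw [ets] at e1 e2
  have hb1 : |η' t| ≤ B := (hB1 t ht).trans (by rw [hB]; simp)
  have hb2 : |c' t| ≤ B := (hB2 t ht).trans (by rw [hB]; simp)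
  have hgen := generator_boosted_nonneg hx hp ht M
  have hL1 : G.massLeft x M ≤ K := (massLeft_le_card hx M).trans (by rw [hK]; linarith)
  have hQ0 : 0 ≤ G.energy x M := energy_nonneg M
  have hQL := energy_le_massLeft hx M
  have hgen' : r * 0 ≤ r * (G.generator x (G.boosted x (η t) (c t)) M + η' t * G.massLeft x M
      - c' t * G.energy x M) := mul_le_mul_of_nonneg_left hgen hr0
  unfold slotOp
  obtain ⟨g, hg⟩ : ∃ g, g = G.generator x (G.boosted x (η t) (c t)) M := ⟨_, rfl⟩
  rw [← hg] at hgen' ⊢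
  unfold boosted
  obtain ⟨L, hL⟩ : ∃ L, L = G.massLeft x M := ⟨_, rfl⟩
  obtain ⟨Q, hQ⟩ : ∃ Q, Q = G.energy x M := ⟨_, rfl⟩
  rw [← hL] at hgen' hL1 hQL ⊢
  rw [← hQ] at hgen' hQ0 hQL ⊢
  have hL0 : 0 ≤ L := hQ0.trans hQL
  have hQ1 : Q ≤ K := hQL.trans hL1
  have k1 : |(η t - η s - δ * η' t) * L| ≤ ε / (4 * K) * δ * K := by
    rw [abs_mul, abs_of_nonneg hL0]; gcongr
  have k2 : |(c t - c s - δ * c' t) * Q| ≤ ε / (4 * K) * δ * K := by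
    rw [abs_mul, abs_of_nonneg hQ0]; gcongr
  have hdr0 : 0 ≤ δ - r := by linarith
  have hdr : δ - r ≤ ε / (4 * K * B) * δ := by
    have : δ * Λ ≤ ε / (4 * K * B * (Λ + 1)) * (Λ + 1) := by
      have := hδd.2.2.le
      gcongr
      linarith
    have e3 : ε / (4 * K * B * (Λ + 1)) * (Λ + 1) = ε / (4 * K * B) := by field_simp
    rw [e3] at this
    nlinarith
  have k3 : |(δ - r) * η' t * L| ≤ ε / (4 * K * B) * δ * B * K := by
    rw [abs_mul, abs_mul, abs_of_nonneg hL0, abs_of_nonneg hdr0]; gcongr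
  have k4 : |(δ - r) * c' t * Q| ≤ ε / (4 * K * B) * δ * B * K := by
    rw [abs_mul, abs_mul, abs_of_nonneg hQ0, abs_of_nonneg hdr0]; gcongr
  have f1 : ε / (4 * K) * δ * K = ε * δ / 4 := by field_simp
  have f2 : ε / (4 * K * B) * δ * B * K = ε * δ / 4 := by field_simp
  rw [f1] at k1 k2
  rw [f2] at k3 k4
  rw [abs_le] at k1 k2 k3 k4
  linarith [k1.1, k2.2, k3.1, k4.2]

lemma slotOp_iterate_ge (hx : G.LPFeasible x) {η c η' c' : ℝ → ℝ} {a b : ℝ}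
    (hp : IsPotential η c η' c' a b) {ε : ℝ} (hε : 0 < ε) :
    ∃ n₀ : ℕ, ∀ n : ℕ, n₀ ≤ n → ∀ k m : ℕ, a ≤ k * (n : ℝ)⁻¹ → (k + m : ℕ) * (n : ℝ)⁻¹ ≤ b →
      ∀ (f : Finset J → ℝ) (κ : ℝ),
      (∀ M, G.boosted x (η ((k + m : ℕ) * (n : ℝ)⁻¹)) (c ((k + m : ℕ) * (n : ℝ)⁻¹)) M - κ ≤ f M) →
      ∀ M, G.boosted x (η (k * (n : ℝ)⁻¹)) (c (k * (n : ℝ)⁻¹)) M - (κ + m * (ε * (n : ℝ)⁻¹))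
        ≤ (G.slotOp x (G.slotRate n))^[m] f M := by
  obtain ⟨n₀, h⟩ := exists_slotOp_boosted_ge hx hp hε
  refine ⟨n₀, fun n hn k m => ?_⟩
  induction m generalizing k with
  | zero => intro _ _ f κ hf M; simpa using hf M
  | succ m ih =>
    intro hak hkb f κ hf M
    rw [Function.iterate_succ_apply']
    have hn0 : 0 ≤ (n : ℝ)⁻¹ := by positivity
    have e : k + 1 + m = k + (m + 1) := by ring
    have ih' := ih (k + 1) (hak.trans (by push_cast; nlinarith)) (by rw [e]; exact hkb) f κ
      (by rw [e]; exact hf)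
    have h1 := slotOp_mono hx (slotRate_nonneg n) (slotRate_mul_le n) ih' M
    refine le_trans ?_ h1
    rw [slotOp_sub_const]
    have h2 := h n hn (k * (n : ℝ)⁻¹) ((k + 1 : ℕ) * (n : ℝ)⁻¹) hak (le_trans (by
      push_cast; nlinarith [(Nat.cast_nonneg m : (0 : ℝ) ≤ m)]) hkb) (by push_cast; ring) M
    push_cast at h2 ⊢
    linarith

/-- In the discretization by `1000 * n` slots, the expected size of the matching is at least
`0.707` times the LP value, up to an arbitrarily small error. -/
theorem slotOp_iterate_card_ge (hx : G.LPFeasible x) {ε : ℝ} (hε : 0 < ε) :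
    ∃ n₀ : ℕ, ∀ n : ℕ, n₀ ≤ n → 0 < n → 0.707 * G.lpValue x - ε
      ≤ (G.slotOp x (G.slotRate (1000 * n)))^[1000 * n] (fun M => (M.card : ℝ)) ∅ := by
  obtain ⟨n₁, h1⟩ := slotOp_iterate_ge hx isPotential_late hε
  obtain ⟨n₂, h2⟩ := slotOp_iterate_ge hx isPotential_early hε
  refine ⟨max n₁ n₂, fun n hn hn0 => ?_⟩
  have hn' : (0 : ℝ) < n := by exact_mod_cast hn0
  have t1 : ((401 * n : ℕ) : ℝ) * ((1000 * n : ℕ) : ℝ)⁻¹ = 401 / 1000 := by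
    push_cast; field_simp
  have t2 : ((401 * n + 599 * n : ℕ) : ℝ) * ((1000 * n : ℕ) : ℝ)⁻¹ = 1 := by
    push_cast; field_simp; norm_num
  have l1 := h1 (1000 * n) (by have := le_max_left n₁ n₂; omega) (401 * n) (599 * n)
    (by rw [t1]) (by rw [t2]) (fun M => (M.card : ℝ)) 0
    (by
      intro M
      rw [t2, late_end.1, late_end.2]
      simp [boosted])
  rw [t1, late_start.1, late_start.2] at l1
  have l2 := h2 (1000 * n) (by have := le_max_right n₁ n₂; omega) 0 (401 * n) (by simp)
    (by rw [zero_add, t1]) _ _ (by rw [zero_add, t1]; exact l1) ∅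
  rw [← Function.iterate_add_apply, show 401 * n + 599 * n = 1000 * n by ring] at l2
  refine le_trans ?_ l2
  have t3 : ((599 * n : ℕ) : ℝ) * (ε * ((1000 * n : ℕ) : ℝ)⁻¹)
      + ((401 * n : ℕ) : ℝ) * (ε * ((1000 * n : ℕ) : ℝ)⁻¹) = ε := by
    push_cast; field_simp; norm_num
  have hL : 0 ≤ G.massLeft x ∅ := (energy_nonneg ∅).trans (energy_le_massLeft hx ∅)
  have hc : 0 ≤ earlyC 0 := by unfold earlyC; positivity
  have hQ := mul_le_mul_of_nonneg_left (energy_le_massLeft hx ∅) hc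
  have hfin := mul_le_mul_of_nonneg_right early_start hL
  unfold boosted
  rw [← massLeft_empty]
  simp only [Nat.cast_zero, zero_mul, Finset.card_empty, zero_add]
  nlinarith

end StochasticMatching

/-! ### The sequence of arrivals and time slots -/

namespace StochasticMatching

set_option linter.unusedSectionVars false

variable {I J : Type*} [Fintype I] [Fintype J] [DecidableEq I] [DecidableEq J]

open Classical in
/-- The letter of a time slot with `m i` arrivals of type `i`: the type of the arriving vertex if
there is exactly one, and `none` otherwise. -/
def letter (m : I → ℕ) : Option I :=
  if h : ∃ i, m = Pi.single i 1 then some h.choose else none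

lemma letter_eq_some_iff {m : I → ℕ} {i : I} : letter m = some i ↔ m = Pi.single i 1 := by
  have hinj : ∀ i i' : I, (Pi.single i 1 : I → ℕ) = Pi.single i' 1 → i = i' := by
    intro i i' h
    by_contra hne
    have := congrFun h i
    simp [Pi.single_eq_of_ne hne] at this
  unfold letter
  split_ifs with h
  · rw [Option.some.injEq]
    constructor
    · rintro rfl; exact h.choose_spec
    · intro hm; exact hinj _ _ (h.choose_spec.symm.trans hm)
  · simp only [false_iff]
    exact fun hm => h ⟨i, hm⟩

/-- The numbers of arrivals of each type during the `k`-th of the `n` slots that partition the time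
horizon. -/
def slotCount (n : ℕ) (c : I → ℝ≥0 → ℕ) (k : ℕ) (i : I) : ℕ :=
  c i ((k + 1 : ℕ) / n) - c i ((k : ℕ) / n)

/-- The letters of the `n` slots for the counting paths `c`. -/
def slotLetters (n : ℕ) (c : I → ℝ≥0 → ℕ) (k : Fin n) : Option I := letter (slotCount n c k)

/-- The first arrival after time `s` comes strictly after `s`, by right-continuity. -/
lemma arrivalTime_mem {c : ℝ≥0 → ℕ} {s t : ℝ≥0} (hmono : Monotone c)
    (hcont : ContinuousWithinAt c (Set.Ici s) s) (hlt : c s < c t) :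
    s < arrivalTime c (c s) ∧ arrivalTime c (c s) ≤ t := by
  have hmem : t ∈ {t | c s < c t} := hlt
  refine ⟨?_, csInf_le (OrderBot.bddBelow _) hmem⟩
  have hev : ∀ᶠ u in nhdsWithin s (Set.Ici s), c u = c s := by
    exact hcont.eventually (IsOpen.mem_nhds (isOpen_discrete {c s}) rfl)
  rw [Filter.Eventually, Metric.mem_nhdsWithin_iff] at hev
  obtain ⟨ε, hε, h⟩ := hev
  refine lt_of_lt_of_le (lt_add_of_pos_right s (show (0 : ℝ≥0) < ⟨ε, hε.le⟩ from hε))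
    (le_csInf ⟨t, hmem⟩ fun u hu => ?_)
  by_contra hlt'
  push Not at hlt'
  have hsu : s ≤ u := by
    by_contra hus
    push Not at hus
    exact absurd (hmono hus.le) (not_le.2 hu)
  have : c u = c s := by
    refine h ⟨?_, hsu⟩
    rw [Metric.mem_ball, NNReal.dist_eq, abs_of_nonneg (sub_nonneg.2 (by exact_mod_cast hsu))]
    have : (u : ℝ) < s + ε := by exact_mod_cast hlt'
    linarith
  exact absurd hu (by simp [this])

/-- If no slot holds two arrivals, then the sequence of the arrivals can be read off the slots. -/
lemma arrivalSeq_eq {n : ℕ} (hn : 0 < n) {c : I → ℝ≥0 → ℕ} (h0 : ∀ i, c i 0 = 0)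
    (hmono : ∀ i, Monotone (c i)) (hcont : ∀ i t, ContinuousWithinAt (c i) (Set.Ici t) t)
    (hslot : ∀ k : Fin n, slotCount n c k = 0 ∨ ∃ i, slotCount n c k = Pi.single i 1) :
    arrivalSeq c = (List.ofFn (slotLetters n c)).reduceOption := by
  have hn0 : (n : ℝ≥0) ≠ 0 := by exact_mod_cast hn.ne'
  have hgrid : ∀ k l : ℕ, k ≤ l → (k : ℝ≥0) / n ≤ (l : ℝ≥0) / n := fun k l h => by
    gcongr
  -- the arrival in the `k`-th slot, if there is one, as an element of the list to be sorted
  let ev : Fin n → Option (Σ _ : I, ℕ) := fun k =>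
    (slotLetters n c k).map fun i => ⟨i, c i ((k : ℕ) / n)⟩
  have hev : ∀ k i a, ev k = some ⟨i, a⟩ ↔
      slotCount n c k = Pi.single i 1 ∧ a = c i ((k : ℕ) / n) := by
    intro k i a
    simp only [ev, slotLetters, Option.map_eq_some_iff, letter_eq_some_iff]
    constructor
    · rintro ⟨i', h, he⟩
      obtain ⟨rfl, h2⟩ := Sigma.mk.inj he
      exact ⟨h, (eq_of_heq h2).symm⟩
    · rintro ⟨h, rfl⟩
      exact ⟨i, h, rfl⟩
  have hjump : ∀ k i, slotCount n c k = Pi.single i 1 →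
      c i ((k : ℕ) / n) < c i ((k + 1 : ℕ) / n) := by
    intro k i h
    have := congrFun h i
    rw [Pi.single_eq_same, slotCount] at this
    omega
  have htime : ∀ k (e : Σ _ : I, ℕ), ev k = some e → ((k : ℕ) : ℝ≥0) / n < arrivalTime (c e.1) e.2 ∧
      arrivalTime (c e.1) e.2 ≤ ((k + 1 : ℕ) : ℝ≥0) / n := by
    rintro k ⟨i, a⟩ he
    obtain ⟨h1, rfl⟩ := (hev k i a).1 he
    exact arrivalTime_mem (hmono i) (hcont i _) (hjump k i h1)
  have hpw : ((List.finRange n).filterMap ev).Pairwise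
      fun a b => arrivalTime (c a.1) a.2 < arrivalTime (c b.1) b.2 := by
    rw [List.pairwise_filterMap]
    refine (List.pairwise_lt_finRange n).imp fun {k l} hkl e he e' he' => ?_
    exact (htime k e he).2.trans_lt ((hgrid _ _ hkl).trans_lt (htime l e' he').1)
  have hnd : ((List.finRange n).filterMap ev).Nodup :=
    hpw.imp fun {a b} h hab => by rw [hab] at h; exact lt_irrefl _ h
  have hperm : ((List.finRange n).filterMap ev).Perm
      ((Finset.univ.sigma fun i => Finset.range (c i 1)).toList : List (Σ _ : I, ℕ)) := by
    rw [List.perm_ext_iff_of_nodup hnd (Finset.nodup_toList _)]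
    rintro ⟨i, a⟩
    simp only [List.mem_filterMap, List.mem_finRange, true_and, Finset.mem_toList,
      Finset.mem_sigma, Finset.mem_univ, Finset.mem_range]
    have hone : ((n : ℕ) : ℝ≥0) / n = 1 := div_self hn0
    constructor
    · rintro ⟨k, hk⟩
      obtain ⟨h1, rfl⟩ := (hev k i a).1 hk
      refine (hjump k i h1).trans_le (hmono i ?_)
      rw [← hone]
      exact hgrid _ _ k.2
    · -- arrival number `a` happens in the slot before the first grid point by which it is counted
      intro ha
      classical
      have hex : ∃ k : ℕ, a < c i ((k : ℕ) / n) := ⟨n, by rwa [hone]⟩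
      obtain ⟨k, hk⟩ : ∃ k, Nat.find hex = k + 1 := by
        refine Nat.exists_eq_succ_of_ne_zero fun h => ?_
        have := Nat.find_spec hex
        rw [h] at this
        simp [h0] at this
      have hlt : a < c i ((k + 1 : ℕ) / n) := hk ▸ Nat.find_spec hex
      have hge : c i ((k : ℕ) / n) ≤ a := not_lt.1 (Nat.find_min hex (by omega))
      have hkn : k < n := by
        have : Nat.find hex ≤ n := Nat.find_min' hex (by rwa [hone])
        omega
      refine ⟨⟨k, hkn⟩, (hev _ i a).2 ?_⟩
      have hpos : 0 < slotCount n c k i := by unfold slotCount; omega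
      rcases hslot ⟨k, hkn⟩ with h | ⟨i', h⟩
      · have := congrFun h i
        simp only [Pi.zero_apply] at this
        omega
      · have hi : i' = i := by
          by_contra hne
          have := congrFun h i
          rw [Pi.single_eq_of_ne (Ne.symm hne)] at this
          simp only at this
          omega
        subst hi
        refine ⟨h, ?_⟩
        have := congrFun h i'
        rw [Pi.single_eq_same] at this
        simp only [slotCount] at this ⊢
        omega
  have hsort : ((Finset.univ.sigma fun i => Finset.range (c i 1)).toList :
      List (Σ _ : I, ℕ)).insertionSort
      (fun a b => arrivalTime (c a.1) a.2 ≤ arrivalTime (c b.1) b.2)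
      = (List.finRange n).filterMap ev := by
    have : Std.Total fun a b : (Σ _ : I, ℕ) =>
      arrivalTime (c a.1) a.2 ≤ arrivalTime (c b.1) b.2 := ⟨fun a b => le_total _ _⟩
    have : IsTrans (Σ _ : I, ℕ) fun a b : (Σ _ : I, ℕ) =>
      arrivalTime (c a.1) a.2 ≤ arrivalTime (c b.1) b.2 := ⟨fun a b d => le_trans⟩
    refine List.Perm.eq_of_pairwise
      (le := fun a b => arrivalTime (c a.1) a.2 ≤ arrivalTime (c b.1) b.2) ?_
      (List.pairwise_insertionSort _ _)
      (hpw.imp fun h => le_of_lt h) ((List.perm_insertionSort _ _).trans hperm.symm)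
    -- distinct members of the second list have distinct arrival times
    intro a b ha hb hab hba
    rw [List.mem_insertionSort, ← hperm.mem_iff] at ha
    by_contra hne
    have hsymm : Std.Symm fun a b : (Σ _ : I, ℕ) =>
        arrivalTime (c a.1) a.2 ≠ arrivalTime (c b.1) b.2 := ⟨fun _ _ h => h.symm⟩
    exact (hpw.imp fun {a b} h => h.ne).forall ha hb hne (le_antisymm hab hba)
  unfold arrivalSeq
  rw [hsort, List.map_filterMap]
  simp only [List.reduceOption, List.ofFn_eq_map, List.filterMap_map]
  congr 1
  funext k
  simp only [ev, Option.map_map, Function.comp_def, id]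
  exact Option.map_id' ..

end StochasticMatching

/-! ### Discretization of the Poisson processes -/

/-- If the members of a family of random variables indexed by pairs are independent, then so are
its rows. -/
lemma iIndepFun_curry {Ω ι κ α : Type*} [MeasurableSpace Ω] [MeasurableSpace α] {P : Measure Ω}
    {X : ι → κ → Ω → α} (mX : ∀ i j, Measurable (X i j))
    (h : iIndepFun (fun (p : ι × κ) ω => X p.1 p.2 ω) P) :
    iIndepFun (fun i ω j => X i j ω) P := by
  have := h.isProbabilityMeasure
  have hp : ∀ i j, IsProbabilityMeasure (P.map (X i j)) :=
    fun i j => Measure.isProbabilityMeasure_map (mX i j).aemeasurable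
  rw [iIndepFun_iff_map_fun_eq_infinitePi_map (by fun_prop)]
  have h1 := (iIndepFun_iff_map_fun_eq_infinitePi_map (by fun_prop)).1 h
  have h2 : ∀ i, P.map (fun ω j => X i j ω) = Measure.infinitePi fun j => P.map (X i j) := by
    intro i
    exact (iIndepFun_iff_map_fun_eq_infinitePi_map (by fun_prop)).1
      (h.precomp (g := fun j => (i, j)) (fun a b hab => (Prod.mk.inj hab).2))
  simp_rw [h2]
  rw [← Measure.infinitePi_map_curry (fun i j => P.map (X i j)), ← h1,
    Measure.map_map (by fun_prop) (by fun_prop)]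
  rfl

namespace StochasticMatching

set_option linter.unusedSectionVars false

variable {I J : Type*} [Fintype I] [Fintype J] [DecidableEq I] [DecidableEq J]
variable {G : StochasticMatching I J} {Ω : Type*} [MeasurableSpace Ω] {P : Measure Ω}
  [IsProbabilityMeasure P] {N : I → ℝ≥0 → Ω → ℕ}

lemma measurable_slotCount (hN : G.PoissonArrivals N P) (n k : ℕ) (i : I) :
    Measurable fun ω => slotCount n (fun i t => N i t ω) k i :=
  ((hN.isPoissonCounting i).measurable _).sub ((hN.isPoissonCounting i).measurable _)

lemma iIndepFun_slotCount_type (hN : G.PoissonArrivals N P) (n k : ℕ) :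
    iIndepFun (fun i ω => slotCount n (fun i t => N i t ω) k i) P :=
  hN.indep.comp (fun _ c => c ((k + 1 : ℕ) / n) - c ((k : ℕ) / n)) fun _ => by fun_prop

lemma iIndepFun_slotCount (hN : G.PoissonArrivals N P) (n : ℕ) :
    iIndepFun (fun k ω => slotCount n (fun i t => N i t ω) k) P := by
  have hmono : Monotone fun k : ℕ => (k : ℝ≥0) / n := fun k l h => by
    have : (k : ℝ≥0) ≤ l := by exact_mod_cast h
    simp only
    gcongr
  have h1 := iIndepFun_uncurry' (X := fun i k ω => slotCount n (fun i t => N i t ω) k i)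
    (fun i k => measurable_slotCount hN n k i)
    (hN.indep.comp (fun _ c k => c ((k + 1 : ℕ) / n) - c ((k : ℕ) / n)) fun _ => by fun_prop)
    fun i => (hN.isPoissonCounting i).hasIndepIncrements.nat hmono
  exact iIndepFun_curry (fun k i => measurable_slotCount hN n k i)
    (h1.precomp (g := Prod.swap) Prod.swap_injective)

lemma measureReal_slotCount (hN : G.PoissonArrivals N P) (n k : ℕ) (m : I → ℕ) :
    P.real {ω | slotCount n (fun i t => N i t ω) k = m}
      = ∏ i, (Real.exp (-((n : ℝ)⁻¹ * G.rate i)) * ((n : ℝ)⁻¹ * G.rate i) ^ m i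
          / (m i).factorial) := by
  have h1 : {ω | slotCount n (fun i t => N i t ω) k = m}
      = ⋂ i, (fun ω => slotCount n (fun i t => N i t ω) k i) ⁻¹' {m i} := by
    ext ω
    simp [funext_iff]
  rw [Measure.real, h1, (iIndepFun_slotCount_type hN n k).meas_iInter
    fun i => ⟨{m i}, measurableSet_singleton _, rfl⟩, ENNReal.toReal_prod]
  refine Finset.prod_congr rfl fun i _ => ?_
  have hle : ((k : ℕ) : ℝ≥0) / n ≤ ((k + 1 : ℕ) : ℝ≥0) / n := by
    push_cast
    gcongr
    exact le_self_add
  have h2 := ((hN.isPoissonCounting i).increment_law _ _ hle).measureReal_eq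
    (p := fun a => a = m i) (measurableSet_singleton _)
  have h3 : G.rate i * (((k + 1 : ℕ) : ℝ≥0) / n - ((k : ℕ) : ℝ≥0) / n)
      = (n : ℝ≥0)⁻¹ * G.rate i := by
    rw [← tsub_div]
    push_cast
    rw [add_tsub_cancel_left, one_div, mul_comm]
  rw [h3] at h2
  refine h2.trans ?_
  have h4 := poissonMeasure_real_singleton ((n : ℝ≥0)⁻¹ * G.rate i) (m i)
  push_cast at h4
  exact h4

lemma measureReal_slotCount_zero (hN : G.PoissonArrivals N P) (n k : ℕ) :
    P.real {ω | slotCount n (fun i t => N i t ω) k = 0}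
      = Real.exp (-((n : ℝ)⁻¹ * ∑ i, (G.rate i : ℝ))) := by
  rw [measureReal_slotCount hN, Finset.mul_sum, ← Finset.sum_neg_distrib, Real.exp_sum]
  simp

lemma measureReal_slotCount_single (hN : G.PoissonArrivals N P) (n k : ℕ) (i : I) :
    P.real {ω | slotCount n (fun i t => N i t ω) k = Pi.single i 1} = G.slotRate n * G.rate i := by
  have h : ∀ i', (Real.exp (-((n : ℝ)⁻¹ * G.rate i')) * ((n : ℝ)⁻¹ * G.rate i') ^
      (Pi.single i 1 : I → ℕ) i' / ((Pi.single i 1 : I → ℕ) i').factorial)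
      = Real.exp (-((n : ℝ)⁻¹ * G.rate i')) * (if i' = i then (n : ℝ)⁻¹ * G.rate i' else 1) := by
    intro i'
    by_cases h : i' = i
    · subst h; simp
    · simp [h]
  rw [measureReal_slotCount hN, Finset.prod_congr rfl fun i' _ => h i', Finset.prod_mul_distrib,
    ← Real.exp_sum, Finset.prod_ite_eq' Finset.univ i, if_pos (Finset.mem_univ i),
    Finset.sum_neg_distrib, ← Finset.mul_sum]
  unfold slotRate
  ring

/-- The event that the `k`-th slot holds at least two arrivals. -/
def crowded (N : I → ℝ≥0 → Ω → ℕ) (n k : ℕ) : Set Ω :=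
  {ω | slotCount n (fun i t => N i t ω) k ≠ 0 ∧
    ∀ i, slotCount n (fun i t => N i t ω) k ≠ Pi.single i 1}

lemma measurable_slotCount_fun (hN : G.PoissonArrivals N P) (n k : ℕ) :
    Measurable fun ω => slotCount n (fun i t => N i t ω) k :=
  measurable_pi_lambda _ fun i => measurable_slotCount hN n k i

/-- With `z` the expected number of arrivals in a slot, the slot is crowded with probability
`1 - exp (-z) - z * exp (-z) ≤ z ^ 2`. -/
lemma measureReal_crowded_le (hN : G.PoissonArrivals N P) (n k : ℕ) :
    P.real (crowded N n k) ≤ ((n : ℝ)⁻¹ * ∑ i, (G.rate i : ℝ)) ^ 2 := by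
  have hmeas : ∀ s : Set (I → ℕ), MeasurableSet
      {ω | slotCount n (fun i t => N i t ω) k ∈ s} := fun s =>
    measurable_slotCount_fun hN n k .of_discrete
  have hsingle : ∀ i : I, (Pi.single i 1 : I → ℕ) ≠ 0 := fun i h => by
    have := congrFun h i
    simp at this
  have hinj : Function.Injective fun i : I => (Pi.single i 1 : I → ℕ) := fun i i' h => by
    have h1 : letter (Pi.single i 1 : I → ℕ) = some i := letter_eq_some_iff.2 rfl
    exact Option.some.inj (h1.symm.trans (letter_eq_some_iff.2 h))
  have hone := measureReal_biUnion_finset (μ := P)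
    (s := insert (0 : I → ℕ) (Finset.univ.image fun i : I => (Pi.single i 1 : I → ℕ)))
    (f := fun m => {ω | slotCount n (fun i t => N i t ω) k = m})
    (fun a _ b _ hab => by
      refine Set.disjoint_left.2 fun ω h1 h2 => hab (h1.symm.trans h2))
    (fun m _ => hmeas {m})
  rw [Finset.sum_insert (by simp), Finset.sum_image fun a _ b _ h => hinj h,
    measureReal_slotCount_zero hN] at hone
  simp_rw [measureReal_slotCount_single hN] at hone
  rw [← Finset.mul_sum] at hone
  have hcompl : crowded N n k = (⋃ m ∈ insert (0 : I → ℕ) (Finset.univ.image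
      fun i : I => (Pi.single i 1 : I → ℕ)), {ω | slotCount n (fun i t => N i t ω) k = m})ᶜ := by
    ext ω
    simp [crowded, eq_comm]
  rw [hcompl, probReal_compl_eq_one_sub, hone]
  · unfold slotRate
    obtain ⟨z, hz⟩ : ∃ z, z = (n : ℝ)⁻¹ * ∑ i, (G.rate i : ℝ) := ⟨_, rfl⟩
    have hz0 : 0 ≤ z := by rw [hz]; positivity
    rw [mul_right_comm, ← hz]
    nlinarith [Real.add_one_le_exp (-z)]
  · exact Finset.measurableSet_biUnion _ fun m _ => hmeas {m}

/-- The resolutions of the time horizon that are used: the numbers of slots are multiples of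
`1000`, so that the end of the early phase is a grid point, and grow geometrically. -/
def resolution (m : ℕ) : ℕ := 1000 * 2 ^ m

/-- By the Borel–Cantelli lemma, almost surely no slot is crowded at any fine enough resolution. -/
lemma ae_eventually_not_crowded (hN : G.PoissonArrivals N P) :
    ∀ᵐ ω ∂P, ∀ᶠ m in Filter.atTop, ∀ k < resolution m, ω ∉ crowded N (resolution m) k := by
  have hb : ∀ m, P (⋃ k ∈ Finset.range (resolution m), crowded N (resolution m) k)
      ≤ ENNReal.ofReal ((∑ i, (G.rate i : ℝ)) ^ 2 * (1 / 2) ^ m) := by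
    intro m
    rw [← ofReal_measureReal (measure_ne_top _ _)]
    refine ENNReal.ofReal_le_ofReal ?_
    refine (measureReal_biUnion_finset_le _ _).trans ?_
    refine (Finset.sum_le_sum fun k _ => measureReal_crowded_le hN _ k).trans ?_
    rw [Finset.sum_const, Finset.card_range, nsmul_eq_mul]
    unfold resolution
    push_cast
    rw [mul_pow, ← mul_assoc, mul_comm]
    refine mul_le_mul_of_nonneg_left ?_ (sq_nonneg _)
    have h2 : (0 : ℝ) < 2 ^ m := by positivity
    rw [inv_pow, one_div, inv_pow]
    field_simp
    norm_num
  have hsum : ∑' m, P (⋃ k ∈ Finset.range (resolution m), crowded N (resolution m) k) ≠ ∞ := by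
    refine ne_top_of_le_ne_top ?_ (ENNReal.tsum_le_tsum hb)
    rw [← ENNReal.ofReal_tsum_of_nonneg (fun m => by positivity)]
    · exact ENNReal.ofReal_ne_top
    · exact (summable_geometric_of_lt_one (by norm_num) (by norm_num)).mul_left _
  filter_upwards [ae_eventually_notMem hsum] with ω hω
  filter_upwards [hω] with m hm k hk hmem
  exact hm (Set.mem_biUnion (Finset.mem_coe.2 (Finset.mem_range.2 hk)) hmem)

/-- The letters of the slots, as a list of types. -/
def slotList (N : I → ℝ≥0 → Ω → ℕ) (m : ℕ) (ω : Ω) : List I :=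
  (List.ofFn (slotLetters (resolution m) fun i t => N i t ω)).reduceOption

lemma resolution_pos (m : ℕ) : 0 < resolution m := by unfold resolution; positivity

lemma ae_eventually_arrivalSeq_eq (hN : G.PoissonArrivals N P) :
    ∀ᵐ ω ∂P, ∀ᶠ m in Filter.atTop,
      slotList N m ω = arrivalSeq fun i t => N i t ω := by
  filter_upwards [ae_eventually_not_crowded hN,
    ae_all_iff.2 fun i => (hN.isPoissonCounting i).paths] with ω hω hpaths
  filter_upwards [hω] with m hm
  refine (arrivalSeq_eq (resolution_pos m) (fun i => (hpaths i).1) (fun i => (hpaths i).2.1)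
    (fun i => (hpaths i).2.2) fun k => ?_).symm
  by_contra! h
  exact hm k k.2 h

/-- The letters of the slots are independent and identically distributed. -/
lemma integral_slotList (hN : G.PoissonArrivals N P) (m : ℕ) :
    ∃ p : Option I → ℝ, (∀ i, p (some i) = G.slotRate (resolution m) * G.rate i) ∧ ∑ o, p o = 1 ∧
      ∀ f : List I → ℝ, Measurable (fun ω => f (slotList N m ω)) ∧ ∫ ω, f (slotList N m ω) ∂P
        = ∑ v : Fin (resolution m) → Option I, (∏ k, p (v k)) * f (List.ofFn v).reduceOption := by
  let : MeasurableSpace (Option I) := ⊤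
  have : DiscreteMeasurableSpace (Option I) := ⟨fun _ => trivial⟩
  let n := resolution m
  have hmeas : ∀ k : ℕ, Measurable fun ω => letter (slotCount n (fun i t => N i t ω) k) :=
    fun k => (Measurable.of_discrete (f := letter)).comp (measurable_slotCount_fun hN n k)
  have hindep : iIndepFun (fun (k : Fin n) ω => slotLetters n (fun i t => N i t ω) k) P :=
    ((iIndepFun_slotCount hN n).comp (fun _ => letter) fun _ => .of_discrete).precomp
      (g := fun k : Fin n => (k : ℕ)) Fin.val_injective
  let p : Option I → ℝ := fun o => o.elim (1 - ∑ i, G.slotRate n * (G.rate i : ℝ))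
    fun i => G.slotRate n * G.rate i
  have hlaw : ∀ (k : ℕ) (o : Option I),
      P.real {ω | letter (slotCount n (fun i t => N i t ω) k) = o} = p o := by
    intro k
    have hs : ∀ i, P.real {ω | letter (slotCount n (fun i t => N i t ω) k) = some i}
        = p (some i) := by
      intro i
      simp_rw [letter_eq_some_iff]
      exact measureReal_slotCount_single hN n k i
    have htot : ∑ o, P.real {ω | letter (slotCount n (fun i t => N i t ω) k) = o} = 1 := by
      rw [← measureReal_biUnion_finset]
      · convert probReal_univ (μ := P)
        ext ω
        simp
      · intro a _ b _ hab
        exact Set.disjoint_left.2 fun ω h1 h2 => hab (h1.symm.trans h2)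
      · intro o _
        exact hmeas k (measurableSet_singleton o)
    rintro (_ | i)
    · rw [Fintype.sum_option, Finset.sum_congr rfl fun i _ => hs i] at htot
      simp only [p, Option.elim] at htot ⊢
      linarith
    · exact hs i
  refine ⟨p, fun i => rfl, ?_, fun f => ?_⟩
  · rw [Fintype.sum_option]
    simp only [p, Option.elim]
    ring
  · have hL : Measurable fun ω => slotLetters n fun i t => N i t ω :=
      measurable_pi_lambda _ fun k => hmeas k
    refine ⟨(Measurable.of_discrete
      (f := fun v : Fin n → Option I => f (List.ofFn v).reduceOption)).comp hL, ?_⟩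
    have h1 := integral_map (μ := P) hL.aemeasurable
      (f := fun v : Fin n → Option I => f (List.ofFn v).reduceOption)
      (Measurable.of_discrete).aestronglyMeasurable
    have := Measure.isProbabilityMeasure_map (μ := P) hL.aemeasurable
    rw [integral_fintype (Integrable.of_finite)] at h1
    refine h1.symm.trans (Finset.sum_congr rfl fun v _ => ?_)
    rw [smul_eq_mul]
    congr 1
    rw [map_measureReal_apply hL (measurableSet_singleton v)]
    have h2 : (fun ω => slotLetters n fun i t => N i t ω) ⁻¹' {v}
        = ⋂ k, (fun ω => slotLetters n (fun i t => N i t ω) k) ⁻¹' {v k} := by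
      ext ω
      simp [funext_iff]
    rw [Measure.real, h2, hindep.meas_iInter fun k => ⟨{v k}, measurableSet_singleton _, rfl⟩,
      ENNReal.toReal_prod]
    exact Finset.prod_congr rfl fun k _ => hlaw k (v k)

/-- Every bounded statistic of the sequence of arrivals is the limit of the same statistic of the
letters of the slots. -/
lemma integrable_and_tendsto (hN : G.PoissonArrivals N P) {f : List I → ℝ} {K : ℝ}
    (hf : ∀ w, |f w| ≤ K) :
    Integrable (fun ω => f (arrivalSeq fun i t => N i t ω)) P ∧
    Filter.Tendsto (fun m => ∫ ω, f (slotList N m ω) ∂P) Filter.atTop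
      (nhds (∫ ω, f (arrivalSeq fun i t => N i t ω) ∂P)) := by
  have hm : ∀ m, Measurable fun ω => f (slotList N m ω) := fun m => by
    obtain ⟨p, _, _, h⟩ := integral_slotList hN m
    exact (h f).1
  have hlim : ∀ᵐ ω ∂P, Filter.Tendsto (fun m => f (slotList N m ω)) Filter.atTop
      (nhds (f (arrivalSeq fun i t => N i t ω))) := by
    filter_upwards [ae_eventually_arrivalSeq_eq hN] with ω hω
    refine tendsto_const_nhds.congr' ?_
    filter_upwards [hω] with m h
    rw [h]
  refine ⟨Integrable.of_bound (aestronglyMeasurable_of_tendsto_ae Filter.atTop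
    (fun m => (hm m).aestronglyMeasurable) hlim) K (.of_forall fun ω => hf _), ?_⟩
  exact tendsto_integral_of_dominated_convergence (fun _ => K)
    (fun m => (hm m).aestronglyMeasurable) (integrable_const K)
    (fun m => .of_forall fun ω => hf _) hlim

end StochasticMatching

/-! ### Competitiveness against the Natural LP -/

lemma integrable_and_integral_poissonMeasure (r : ℝ≥0) :
    Integrable (fun n : ℕ => (n : ℝ)) (poissonMeasure r) ∧
      ∫ n : ℕ, (n : ℝ) ∂(poissonMeasure r) = r := by
  have hs : HasSum (fun n : ℕ => Real.exp (-r) * (r : ℝ) ^ n / n.factorial * (n : ℝ)) r := by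
    rw [← hasSum_nat_add_iff' 1]
    have h := (hasSum_one_poissonMeasure r).mul_left (r : ℝ)
    rw [mul_one] at h
    simp only [Finset.range_one, Finset.sum_singleton, Nat.cast_zero, mul_zero, sub_zero]
    refine h.congr_fun fun n => ?_
    rw [Nat.factorial_succ]
    push_cast
    field_simp
    ring
  have hi : Integrable (fun n : ℕ => (n : ℝ)) (poissonMeasure r) := by
    rw [integrable_poissonMeasure_iff]
    refine hs.summable.congr fun n => ?_
    simp
  exact ⟨hi, ((hasSum_integral_poissonMeasure hi).unique (by simpa using hs))⟩

lemma List.card_filter_get_eq {α : Type*} [DecidableEq α] (w : List α) (a : α) :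
    (Finset.univ.filter fun k : Fin w.length => w.get k = a).card = w.count a := by
  conv_rhs => rw [← List.ofFn_get w, List.ofFn_eq_map, List.count, List.countP_map]
  rw [Finset.card, Finset.filter_val, ← Multiset.countP_eq_card_filter]
  refine (Multiset.coe_countP _ (List.finRange w.length)).trans (List.countP_congr fun k _ => ?_)
  simp

namespace StochasticMatching

set_option linter.unusedSectionVars false

variable {I J : Type*} [Fintype I] [Fintype J] [DecidableEq I] [DecidableEq J]
variable {G : StochasticMatching I J} {x : I → J → ℝ} {Ω : Type*} [MeasurableSpace Ω]
  {P : Measure Ω} [IsProbabilityMeasure P] {N : I → ℝ≥0 → Ω → ℕ}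

lemma abs_sworSize_le (w : List I) : |G.sworSize x w| ≤ Fintype.card J := by
  have h1 : ∑ M : Finset J, (G.sworRun x ∅ w M).toReal = 1 := by
    rw [← ENNReal.toReal_sum fun M _ => PMF.apply_ne_top _ _,
      ← tsum_fintype (L := .unconditional _), PMF.tsum_coe, ENNReal.toReal_one]
  unfold sworSize
  rw [abs_of_nonneg (Finset.sum_nonneg fun M _ => by positivity)]
  calc _ ≤ ∑ M : Finset J, (G.sworRun x ∅ w M).toReal * (Fintype.card J : ℝ) := by
        gcongr with M
        exact Finset.card_le_univ M
    _ = _ := by rw [← Finset.sum_mul, h1, one_mul]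

/-- The competitiveness against the value of any feasible solution of the Natural LP. -/
theorem lpValue_le_integral_sworSize (hN : G.PoissonArrivals N P) (hx : G.LPFeasible x) :
    (0.707 : ℝ) * G.lpValue x ≤ ∫ ω, G.sworSize x (arrivalSeq fun i t => N i t ω) ∂P := by
  refine le_of_forall_pos_sub_le fun ε hε => ?_
  obtain ⟨n₀, h⟩ := slotOp_iterate_card_ge (G := G) hx hε
  refine ge_of_tendsto (integrable_and_tendsto hN (f := G.sworSize x) abs_sworSize_le).2 ?_
  have hpow := tendsto_pow_atTop_atTop_of_one_lt (one_lt_two : (1 : ℕ) < 2)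
  filter_upwards [hpow.eventually_ge_atTop n₀] with m hm
  obtain ⟨p, hp, hp1, hint⟩ := integral_slotList hN m
  rw [(hint _).2]
  refine (h (2 ^ m) hm (by positivity)).trans_eq ?_
  exact (sum_slots hx hp hp1 (fun M => (M.card : ℝ)) (resolution m) ∅).symm

/-! ### The Natural LP bounds the hindsight optimum -/

lemma card_le_of_isMatching {w : List I} {M : Finset (Fin w.length × J)}
    (hM : G.IsMatching w M) : M.card ≤ Fintype.card J :=
  Finset.card_le_card_of_injOn (t := Finset.univ) Prod.snd (fun _ _ => Finset.mem_univ _)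
    fun e he e' he' h => hM.offline e he e' he' h

lemma exists_isMatching_card_eq (G : StochasticMatching I J) (w : List I) :
    ∃ M, G.IsMatching w M ∧ M.card = G.hindsightOpt w := by
  classical
  have hne : (Finset.univ.filter (G.IsMatching w)).Nonempty :=
    ⟨∅, by simp only [Finset.mem_filter, Finset.mem_univ, true_and]; constructor <;> simp⟩
  obtain ⟨M, hM, h⟩ := Finset.exists_mem_eq_sup _ hne Finset.card
  refine ⟨M, (Finset.mem_filter.1 hM).2, ?_⟩
  unfold hindsightOpt
  convert h.symm

/-- A maximum matching of the realized bipartite graph, chosen as a function of the arrivals. -/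
def optMatching (G : StochasticMatching I J) (w : List I) : Finset (Fin w.length × J) :=
  (exists_isMatching_card_eq G w).choose

lemma isMatching_optMatching (w : List I) : G.IsMatching w (G.optMatching w) :=
  (exists_isMatching_card_eq G w).choose_spec.1

lemma card_optMatching (w : List I) : (G.optMatching w).card = G.hindsightOpt w :=
  (exists_isMatching_card_eq G w).choose_spec.2

/-- The number of the online vertices of type `i` that a maximum matching matches to `j`. -/
def optCount (G : StochasticMatching I J) (i : I) (j : J) (w : List I) : ℕ :=
  ((G.optMatching w).filter fun e => (w.get e.1, e.2) = (i, j)).card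

lemma sum_optCount (w : List I) :
    ∑ e ∈ G.edges, G.optCount e.1 e.2 w = G.hindsightOpt w := by
  rw [← card_optMatching]
  exact (Finset.card_eq_sum_card_fiberwise (f := fun e => (w.get e.1, e.2))
    (t := G.edges) fun e he => (isMatching_optMatching w).edge e he).symm

lemma sum_optCount_le_count (i : I) (w : List I) (s : Finset J) :
    ∑ j ∈ s, G.optCount i j w ≤ w.count i := by
  rw [← List.card_filter_get_eq]
  unfold optCount
  rw [← Finset.card_biUnion]
  · refine Finset.card_le_card_of_injOn Prod.fst ?_ ?_
    · intro e he
      simp only [Finset.coe_biUnion, Set.mem_iUnion, Finset.mem_coe, Finset.mem_filter,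
        Prod.mk.injEq] at he ⊢
      obtain ⟨j, _, _, h, _⟩ := he
      exact ⟨Finset.mem_univ _, h⟩
    · intro e he e' he' h
      simp only [Finset.coe_biUnion, Set.mem_iUnion, Finset.mem_coe, Finset.mem_filter] at he he'
      obtain ⟨_, _, he, _⟩ := he
      obtain ⟨_, _, he', _⟩ := he'
      exact (isMatching_optMatching w).online e he e' he' h
  · intro j _ j' _ hne
    refine Finset.disjoint_left.2 fun e h1 h2 => hne ?_
    simp only [Finset.mem_filter, Prod.mk.injEq] at h1 h2
    exact h1.2.2.symm.trans h2.2.2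

lemma sum_optCount_le_one (j : J) (w : List I) (S : Finset I) :
    ∑ i ∈ S, G.optCount i j w ≤ if ∃ i ∈ S, w.count i ≠ 0 then 1 else 0 := by
  split_ifs with h
  · unfold optCount
    rw [← Finset.card_biUnion]
    · rw [Finset.card_le_one]
      intro e he e' he'
      simp only [Finset.mem_biUnion, Finset.mem_filter, Prod.mk.injEq] at he he'
      obtain ⟨_, _, he, _, h1⟩ := he
      obtain ⟨_, _, he', _, h2⟩ := he'
      exact (isMatching_optMatching w).offline e he e' he' (h1.trans h2.symm)
    · intro i _ i' _ hne
      refine Finset.disjoint_left.2 fun e h1 h2 => hne ?_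
      simp only [Finset.mem_filter, Prod.mk.injEq] at h1 h2
      exact h1.2.1.symm.trans h2.2.1
  · push Not at h
    refine (Finset.sum_eq_zero fun i hi => ?_).le
    have := sum_optCount_le_count (G := G) i w {j}
    rw [Finset.sum_singleton, h i hi] at this
    omega

lemma count_arrivalSeq (c : I → ℝ≥0 → ℕ) (i : I) : (arrivalSeq c).count i = c i 1 := by
  unfold arrivalSeq
  rw [((List.perm_insertionSort _ _).map Sigma.fst).count_eq, List.count, List.countP_map]
  have h1 : (({i} : Finset I).sigma fun i => Finset.range (c i 1)).card = c i 1 := by simp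
  have h2 : (Finset.univ.sigma fun i => Finset.range (c i 1)).filter
      (fun e : (Σ _ : I, ℕ) => e.1 = i) = ({i} : Finset I).sigma fun i => Finset.range (c i 1) := by
    ext ⟨i', a⟩
    simp only [Finset.mem_filter, Finset.mem_sigma, Finset.mem_univ, Finset.mem_singleton]
    tauto
  rw [← h2] at h1
  refine Eq.trans ?_ h1
  rw [Finset.card, Finset.filter_val, ← Multiset.countP_eq_card_filter, ← Finset.coe_toList,
    Multiset.coe_countP]
  refine List.countP_congr fun e _ => ?_
  simp

lemma hasLaw_arrivals (hN : G.PoissonArrivals N P) (i : I) :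
    HasLaw (N i 1) (poissonMeasure (G.rate i)) P := by
  have h := (hN.isPoissonCounting i).increment_law 0 1 zero_le_one
  rw [tsub_zero, mul_one] at h
  refine h.congr ?_
  filter_upwards [(hN.isPoissonCounting i).paths] with ω hω
  rw [hω.1, Nat.sub_zero]

lemma measureReal_exists_arrival (hN : G.PoissonArrivals N P) (S : Finset I) :
    P.real {ω | ∃ i ∈ S, N i 1 ω ≠ 0} = 1 - Real.exp (-∑ i ∈ S, (G.rate i : ℝ)) := by
  have h1 : {ω | ∃ i ∈ S, N i 1 ω ≠ 0} = (⋂ i ∈ S, N i 1 ⁻¹' {0})ᶜ := by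
    ext ω
    simp
  have hind : iIndepFun (fun i => N i 1) P :=
    hN.indep.comp (fun _ c => c 1) fun _ => by fun_prop
  have hm : ∀ i, MeasurableSet (N i 1 ⁻¹' {0}) := fun i =>
    (hN.isPoissonCounting i).measurable 1 (measurableSet_singleton 0)
  rw [h1, probReal_compl_eq_one_sub (Finset.measurableSet_biInter _ fun i _ => hm i), Measure.real,
    hind.meas_biInter fun i _ => ⟨{0}, measurableSet_singleton _, rfl⟩, ENNReal.toReal_prod,
    ← Finset.sum_neg_distrib, Real.exp_sum]
  congr 1
  refine Finset.prod_congr rfl fun i _ => ?_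
  have h2 := (hasLaw_arrivals hN i).measureReal_eq (p := fun a => a = 0) (measurableSet_singleton 0)
  refine h2.trans ((poissonMeasure_real_singleton (G.rate i) 0).trans ?_)
  simp

lemma optCount_le_one (i : I) (j : J) (w : List I) : G.optCount i j w ≤ 1 := by
  have := sum_optCount_le_one (G := G) j w {i}
  rw [Finset.sum_singleton] at this
  exact this.trans (by split_ifs <;> omega)

lemma integrable_optCount (hN : G.PoissonArrivals N P) (i : I) (j : J) :
    Integrable (fun ω => (G.optCount i j (arrivalSeq fun i t => N i t ω) : ℝ)) P :=
  (integrable_and_tendsto hN (f := fun w => (G.optCount i j w : ℝ)) (K := 1) fun w => by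
    rw [abs_of_nonneg (Nat.cast_nonneg _)]
    exact_mod_cast optCount_le_one i j w).1

/-- The expected numbers of online vertices of type `i` that a maximum matching matches to `j` form
a feasible solution of the Natural LP. -/
lemma lpFeasible_optCount (hN : G.PoissonArrivals N P) : G.LPFeasible fun i j =>
    ∫ ω, (G.optCount i j (arrivalSeq fun i t => N i t ω) : ℝ) ∂P where
  online i := by
    rw [← integral_finsetSum _ fun j _ => integrable_optCount hN i j]
    obtain ⟨h1, h2⟩ := integrable_and_integral_poissonMeasure (G.rate i)
    have hlaw := hasLaw_arrivals hN i
    have h3 : Integrable (fun ω => (N i 1 ω : ℝ)) P := by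
      rw [← hlaw.map_eq] at h1
      exact h1.comp_aemeasurable hlaw.aemeasurable
    have h4 : ∫ ω, (N i 1 ω : ℝ) ∂P = G.rate i := by
      rw [← h2]
      exact hlaw.integral_comp (f := fun n : ℕ => (n : ℝ)) h1.aestronglyMeasurable
    rw [← h4]
    refine integral_mono (integrable_finsetSum _ fun j _ => integrable_optCount hN i j) h3
      fun ω => ?_
    have := sum_optCount_le_count (G := G) i (arrivalSeq fun i t => N i t ω) (G.offlineNbrs i)
    rw [count_arrivalSeq] at this
    simp only
    exact_mod_cast this
  offline j S _ := by
    have hm : MeasurableSet {ω | ∃ i ∈ S, N i 1 ω ≠ 0} := by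
      have : {ω | ∃ i ∈ S, N i 1 ω ≠ 0} = ⋃ i ∈ S, (N i 1 ⁻¹' {0})ᶜ := by ext ω; simp
      rw [this]
      exact Finset.measurableSet_biUnion _ fun i _ =>
        ((hN.isPoissonCounting i).measurable 1 (measurableSet_singleton 0)).compl
    rw [← integral_finsetSum _ fun i _ => integrable_optCount hN i j,
      ← measureReal_exists_arrival hN, ← integral_indicator_one hm]
    refine integral_mono (integrable_finsetSum _ fun i _ => integrable_optCount hN i j)
      ((integrable_const 1).indicator hm) fun ω => ?_
    have := sum_optCount_le_one (G := G) j (arrivalSeq fun i t => N i t ω) S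
    simp_rw [count_arrivalSeq] at this
    simp only [Set.indicator_apply, Set.mem_ofPred_eq, Pi.one_apply]
    split_ifs at this ⊢ <;> exact_mod_cast this
  nonneg e _ := integral_nonneg fun ω => Nat.cast_nonneg _

lemma lpValue_optCount (hN : G.PoissonArrivals N P) : G.lpValue (fun i j =>
    ∫ ω, (G.optCount i j (arrivalSeq fun i t => N i t ω) : ℝ) ∂P)
      = ∫ ω, (G.hindsightOpt (arrivalSeq fun i t => N i t ω) : ℝ) ∂P := by
  unfold lpValue
  rw [← integral_finsetSum _ fun e _ => integrable_optCount hN e.1 e.2]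
  congr 1
  funext ω
  rw [← sum_optCount]
  push_cast
  rfl

end StochasticMatching

/-- Stochastic SWOR is at least `0.707`-competitive for Online Stochastic Matching, both against the
optimum of the Natural LP and against the expected optimal matching in hindsight. -/
theorem mainTheorem2 {I J : Type*} [Fintype I] [Fintype J] [DecidableEq I] [DecidableEq J]
    (G : StochasticMatching I J)
    {Ω : Type*} [MeasurableSpace Ω] (P : Measure Ω) [IsProbabilityMeasure P]
    (N : I → ℝ≥0 → Ω → ℕ) (hN : G.PoissonArrivals N P)
    (x : I → J → ℝ) (hx : G.LPOptimal x) :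
    Integrable (fun ω => G.sworSize x (StochasticMatching.arrivalSeq fun i t => N i t ω)) P ∧
    Integrable
      (fun ω => (G.hindsightOpt (StochasticMatching.arrivalSeq fun i t => N i t ω) : ℝ)) P ∧
    (0.707 : ℝ) * G.lpValue x ≤
      ∫ ω, G.sworSize x (StochasticMatching.arrivalSeq fun i t => N i t ω) ∂P ∧
    (0.707 : ℝ) *
        ∫ ω, (G.hindsightOpt (StochasticMatching.arrivalSeq fun i t => N i t ω) : ℝ) ∂P ≤
      ∫ ω, G.sworSize x (StochasticMatching.arrivalSeq fun i t => N i t ω) ∂P := by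
  have hlp := StochasticMatching.lpValue_le_integral_sworSize hN hx.1
  refine ⟨(StochasticMatching.integrable_and_tendsto hN StochasticMatching.abs_sworSize_le).1,
    (StochasticMatching.integrable_and_tendsto hN (f := fun w => (G.hindsightOpt w : ℝ))
      (K := Fintype.card J) fun w => ?_).1, hlp, le_trans ?_ hlp⟩
  · rw [abs_of_nonneg (Nat.cast_nonneg _), ← StochasticMatching.card_optMatching]
    exact_mod_cast StochasticMatching.card_le_of_isMatching
      (StochasticMatching.isMatching_optMatching w)
  · rw [← StochasticMatching.lpValue_optCount hN]
    exact mul_le_mul_of_nonneg_left (hx.2 _ (StochasticMatching.lpFeasible_optCount hN))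
      (by norm_num)

end
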